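/- For a set $A$ of primes let $\mathbb Z[A^{-1}]\subseteq\mathbb Q$ be the subring generated by the inverses of the elements of $A$. Fix a computable enumeration without repetitions $f_1,f_2,\dots$ of all polynomials with integer coefficients in the variables $X_1,X_2,\dots$, and for a subring $A\subseteq\mathbb Q$ let $\operatorname{HTP}(A)$ be the set of indices $e\ge 1$ such that $f_e$ has a root with coordinates in $A$. Let $W=\{q_1,q_2,\dots\}$ be an infinite c.e. set of primes, given by a computable enumeration without repetitions; let $R$ be a computable set of primes disjoint from $W$, and let $M=W\cup R$. Let $g$ be a computable bijection from the positive integers onto the set of triples $(f,\vec x,j)$ such that, for some $n\ge 0$, $f\in\mathbb Z[X_1,\dots,X_n]$, $\vec x\in(\mathbb Z[M^{-1}])^n$ and $j\in\mathbb Z_{>0}$. Let $h:\mathbb Z_{\ge0}\to\mathbb Z_{\ge0}$ be a computable function with $h(0)=0$. Define finite sets of primes $S_s$ and boolean variables $\mathtt R_e$ in stages. At stage $0$, $S_0=\emptyset$, $\mathtt R_0$ is TRUE and $\mathtt R_e$ is FALSE for all $e>0$. At stage $s>0$, write $g(s)=(f_e,\vec x,j)$ and let $V_s$ be the set of the first $h(s)$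 elements, in the order of the enumeration $q_1,q_2,\dots$, of $W\setminus S_{s-1}$. If $\mathtt R_e$ is FALSE, all coordinates of $\vec x$ lie in $\mathbb Z[(M\setminus V_s)^{-1}]$ and $f_e(\vec x)=0$, then let $S_s=S_{s-1}\cup T_s$, where $T_s$ is the set of primes dividing the denominator of some coordinate of $\vec x$, and set $\mathtt R_e$ to TRUE. Otherwise let $S_s=S_{s-1}$. Let $S=\bigcup_s S_s$. Let $s_0=0$ and, for $e\ge1$, let $s_e$ be the least integer $s>s_{e-1}$ such that all those variables among $\mathtt R_1,\dots,\mathtt R_{e-1}$ that are ever set to TRUE have been set to TRUE by stage $s$, and such that $g(s)=(f_e,\vec x,j)$ for some $\vec x,j$. Suppose that 1. $h(s_e)\to\infty$ as $e\to\infty$; 2. $h(s_e)\le h(s')$ whenever $e\ge1$, $s'>s_e$ and $g(s')=(f_{e'},\vec x,j)$ for some $e'>e$ and some $\vec x,j$; 3. $h(s)=h(s_e)$ whenever $e\ge1$, $s\ge s_e$ and $g(s)=(f_e,\vec x,j)$ for some $\vec x,j$. Then $S$ is computably enumerable and $\operatorname{HTP}(\mathbb Z[S^{-1}])\le_T\operatorname{HTP}(\mathbb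 Z[M^{-1}])$. -/

import Mathlib

namespace PriorityHTP

/-! ### Computability over numbered sets -/

/-- `F : ℕ → X` is computable with respect to the numbering `δ : C → X`: an algorithm
produces, from `n`, a code of `F n`. -/
def ComputableVia {C X : Type} [Primcodable C] (δ : C → X) (F : ℕ → X) : Prop :=
  ∃ G : ℕ → C, Computable G ∧ ∀ n, δ (G n) = F n

/-- Integer polynomials in the countably many variables `X 0, X 1, …`. -/
abbrev Poly : Type := MvPolynomial ℕ ℤ

/-- A polynomial is coded by a finite list of terms, each given by a list of exponents
(of `X 0`, `X 1`, …) and an integer coefficient. -/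
noncomputable def polyOfCode (l : List (List ℕ × ℤ)) : Poly :=
  (l.map fun t => MvPolynomial.monomial t.1.toFinsupp t.2).sum

/-- The pair `(a, b)` codes the rational number `a / (b + 1)`. -/
def ratOfCode (c : ℤ × ℕ) : ℚ := (c.1 : ℚ) / ((c.2 : ℚ) + 1)

/-- Codes of triples (polynomial, finite tuple of rationals, natural number). -/
noncomputable def tripleOfCode (c : List (List ℕ × ℤ) × List (ℤ × ℕ) × ℕ) :
    Poly × List ℚ × ℕ :=
  (polyOfCode c.1, c.2.1.map ratOfCode, c.2.2)

open Classical in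
/-- The characteristic function of a set of natural numbers. -/
noncomputable def charFun (A : Set ℕ) : ℕ →. ℕ :=
  fun n => Part.some (if n ∈ A then 1 else 0)

/-- Turing reducibility between sets of natural numbers. -/
def SetTuringReducible (A B : Set ℕ) : Prop :=
  TuringReducible (charFun A) (charFun B)

/-! ### The rings and Hilbert's Tenth Problem -/

/-- The subring `ℤ[S⁻¹]` of `ℚ`. -/
def ringInv (S : Set ℕ) : Subring ℚ :=
  Subring.closure ((fun p : ℕ => (p : ℚ)⁻¹) '' S)

/-- `HTP(A)`: the set of positive indices `e` such that `f e` has a root with coordinates in `A`.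
A polynomial involves only finitely many variables, so that assigning values to all the
variables amounts to choosing a tuple of the appropriate finite length. -/
def HTP (f : ℕ → Poly) (A : Subring ℚ) : Set ℕ :=
  {e | 0 < e ∧ ∃ x : ℕ → A, MvPolynomial.aeval x (f e) = 0}

/-- The set of the triples `(p, x, j)` with `p ∈ ℤ[X_1, …, X_n]`, `x ∈ ℤ[M⁻¹]ⁿ` for some `n`
(the length of `x`) and `j` a positive integer. -/
def triples (M : Set ℕ) : Set (Poly × List ℚ × ℕ) :=
  {t | (∀ i ∈ t.1.vars, i < t.2.1.length) ∧ (∀ a ∈ t.2.1, a ∈ ringInv M) ∧ 0 < t.2.2}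

/-- The value of `p` at the tuple `x`. -/
noncomputable def evalTuple (p : Poly) (x : List ℚ) : ℚ :=
  MvPolynomial.aeval (fun i => x.getD i 0) p

/-- The primes that occur in the denominators of the entries of `x`. -/
def denPrimes (x : List ℚ) : Set ℕ :=
  {p | p.Prime ∧ ∃ a ∈ x, p ∣ a.den}

/-! ### The construction -/

open Classical in
/-- The set of the first `n` elements of the sequence `q 0, q 1, …` that are not in `S`. -/
def firstOutside (q : ℕ → ℕ) (S : Set ℕ) (n : ℕ) : Set ℕ :=
  {p | ∃ i, q i = p ∧ q i ∉ S ∧ ((Finset.range i).filter fun k => q k ∉ S).card < n}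

/-- The positive index of `p` in the list `f 1, f 2, …` of all the polynomials. -/
noncomputable def polyIndex (f : ℕ → Poly) (p : Poly) : ℕ :=
  sInf {e | 0 < e ∧ f e = p}

/-- The state at the end of a stage: the set of primes inverted so far, and the set of the
indices `e` whose boolean variable `R_e` is TRUE. -/
structure State where
  inverted : Set ℕ
  isTrue : Set ℕ

open Classical in
/-- The state at the end of stage `s`. Here `q` lists `W`, `M = W ∪ R`, `f` lists the polynomials,
`g` lists the triples and `h` bounds the number of protected primes. -/
noncomputable def stage (q : ℕ → ℕ) (M : Set ℕ) (f : ℕ → Poly) (g : ℕ → Poly × List ℚ × ℕ)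
    (h : ℕ → ℕ) : ℕ → State
  | 0 => ⟨∅, {0}⟩
  | s + 1 =>
    let prev := stage q M f g h s
    let e := polyIndex f (g (s + 1)).1
    let x := (g (s + 1)).2.1
    let V := firstOutside q prev.inverted (h (s + 1))
    if e ∉ prev.isTrue ∧ (∀ a ∈ x, a ∈ ringInv (M \ V)) ∧ evalTuple (f e) x = 0 then
      ⟨prev.inverted ∪ denPrimes x, insert e prev.isTrue⟩
    else prev

/-- The set `S` of all the primes inverted at some stage. -/
def invertedSet (q : ℕ → ℕ) (M : Set ℕ) (f : ℕ → Poly) (g : ℕ → Poly × List ℚ × ℕ)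
    (h : ℕ → ℕ) : Set ℕ :=
  ⋃ s, (stage q M f g h s).inverted

/-- The stages `s_e`: `s_0 = 0`, and `s_e` is the least `s > s_{e-1}` such that those of
`R_1, …, R_{e-1}` that are ever set to TRUE have been set to TRUE by stage `s`, and such that
`g s = (f e, x, j)` for some `x` and `j`. -/
noncomputable def keyStage (q : ℕ → ℕ) (M : Set ℕ) (f : ℕ → Poly) (g : ℕ → Poly × List ℚ × ℕ)
    (h : ℕ → ℕ) : ℕ → ℕ
  | 0 => 0
  | e + 1 => sInf {s | keyStage q M f g h e < s ∧
      (∀ i, 1 ≤ i → i ≤ e → (∃ t, i ∈ (stage q M f g h t).isTrue) →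
        i ∈ (stage q M f g h s).isTrue) ∧
      ∃ x j, g s = (f (e + 1), x, j)}

/-- The three conditions imposed on `h`. -/
structure Admissible (q : ℕ → ℕ) (M : Set ℕ) (f : ℕ → Poly) (g : ℕ → Poly × List ℚ × ℕ)
    (h : ℕ → ℕ) : Prop where
  tendsto : Filter.Tendsto (fun e => h (keyStage q M f g h e)) Filter.atTop Filter.atTop
  le_of_lt : ∀ e, 1 ≤ e → ∀ e', e < e' → ∀ s', keyStage q M f g h e < s' →
    (∃ x j, g s' = (f e', x, j)) → h (keyStage q M f g h e) ≤ h s'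
  eq_of_le : ∀ e, 1 ≤ e → ∀ s, keyStage q M f g h e ≤ s →
    (∃ x j, g s = (f e, x, j)) → h s = h (keyStage q M f g h e)

end PriorityHTP

/-! Fix `e ≥ 1` and let `V` be the set of primes protected at stage `s_e`. From that stage on no
action inverts an element of `V`: an index below `e` that ever acts has already acted, and the
conditions on `h` make every later stage with index `≥ e` protect at least as many primes. So `V`
remains the set of the first `h(s_e)` terms outside the growing set, and is disjoint from `S`
(`firstOutside_eq_protectedPrimes`). Consequently `f_e` has a root in `ℤ[S⁻¹]` if and only if it has
one in `ℤ[(M ∖ V)⁻¹]`: on the one hand `S ⊆ M ∖ V`; on the other, a root of the second kind is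
listed again and again, and sooner or later `R_e` is set to TRUE (`mem_HTP_iff_hasRootWith`).

The second condition must become a question about `ℤ[M⁻¹]`. A rational number lies in `ℤ[(M ∖ V)⁻¹]`
when it lies in `ℤ[M⁻¹]` and in `ℤ_(p)` for each of the finitely many `p ∈ V`. It is therefore
enough to define `ℤ_(p)` existentially, uniformly in `p` and with integer witnesses, since integers
belong to every subring of `ℚ`. For `r` a suitable nonresidue, the quaternion norm form `x² - r u² -
p t² + r p w²` is anisotropic over `ℚ_p`, so that `4 + p q²` is represented by `x² - r u² + r p w²`
only if `q ∈ ℤ_(p)`. Conversely, Dirichlet's and Legendre's theorems represent these values for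
enough integers `q` (`exists_representation`), and a Bézout relation passes from integers to all of
`ℤ_(p)` (`of_conjunction_eq_zero`, `exists_conjunction_eq_zero`).

The reduction is a recursion on `e` with one question per step. The answers for smaller indices tell
which variables ever become TRUE; hence `s_e` is found by search, `V` is computed, and the
polynomial `PolyCode.localize` is submitted to the oracle. The stages themselves are computable,
which also makes `S` c.e. -/

namespace PriorityHTP

/-! ### Ternary quadratic forms -/

/-- Legendre's theorem on the zeros of `l x² + b y² - c z²`, when `l` is a prime. -/
theorem exists_zero_ternary {l b c : ℕ} (hl : l.Prime) (hb : 0 < b) (hc : 0 < c)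
    (hlb : l.Coprime b) (hlc : l.Coprime c) (hbc : b.Coprime c) {β γ δ : ℤ}
    (h1 : (l : ℤ) ∣ β ^ 2 - b * c) (h2 : (b : ℤ) ∣ γ ^ 2 - c * l)
    (h3 : (c : ℤ) ∣ δ ^ 2 + l * b) :
    ∃ x y z : ℤ, (x ≠ 0 ∨ y ≠ 0 ∨ z ≠ 0) ∧ l * x ^ 2 + b * y ^ 2 = c * z ^ 2 := by
  have hl0 := hl.pos
  have : NeZero l := ⟨hl0.ne'⟩
  have : NeZero b := ⟨hb.ne'⟩
  have : NeZero c := ⟨hc.ne'⟩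
  -- The box has more than `l b c` points, so two of them agree under the linear congruences
  -- collected in `F`. Their difference makes the form divisible by each of `l`, `b`, `c`, with `x²
  -- ≤ bc`, `y² ≤ cl`, `z² ≤ lb`.
  let s : Finset (ℕ × ℕ × ℕ) := Finset.range (Nat.sqrt (b * c) + 1) ×ˢ
    (Finset.range (Nat.sqrt (c * l) + 1) ×ˢ Finset.range (Nat.sqrt (l * b) + 1))
  let F : ℕ × ℕ × ℕ → ZMod l × ZMod b × ZMod c := fun v =>
    (((b * v.2.1 - β * v.2.2 : ℤ) : ZMod l), ((l * v.1 - γ * v.2.2 : ℤ) : ZMod b),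
      ((l * v.1 - δ * v.2.1 : ℤ) : ZMod c))
  have hcard : (Finset.univ : Finset (ZMod l × ZMod b × ZMod c)).card < s.card := by
    simp only [s, Finset.card_univ, Fintype.card_prod, ZMod.card, Finset.card_product,
      Finset.card_range]
    have e1 := Nat.lt_succ_sqrt (b * c)
    have e2 := Nat.lt_succ_sqrt (c * l)
    have e3 := Nat.lt_succ_sqrt (l * b)
    refine lt_of_pow_lt_pow_left₀ 2 (Nat.zero_le _) ?_
    calc (l * (b * c)) ^ 2 = (b * c) * ((c * l) * (l * b)) := by ring
      _ < _ := Nat.mul_lt_mul'' e1 (Nat.mul_lt_mul'' e2 e3)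
      _ = _ := by simp only [Nat.succ_eq_add_one]; ring
  obtain ⟨⟨x₁, y₁, z₁⟩, hv, ⟨x₂, y₂, z₂⟩, hw, hne, heq⟩ :=
    Finset.exists_ne_map_eq_of_card_lt_of_maps_to hcard (f := F) (fun _ _ => Finset.mem_univ _)
  simp only [s, Finset.mem_product, Finset.mem_range, Nat.lt_succ_iff] at hv hw
  simp only [F, Prod.mk.injEq, ZMod.intCast_eq_intCast_iff_dvd_sub] at heq
  obtain ⟨k1, k2, k3⟩ := heq
  have bound : ∀ {m u v : ℕ}, u ≤ Nat.sqrt m → v ≤ Nat.sqrt m → ((v : ℤ) - u) ^ 2 ≤ m := by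
    intro m u v hu hv
    have hs : (Nat.sqrt m : ℤ) * Nat.sqrt m ≤ m := by exact_mod_cast Nat.sqrt_le m
    have hu' : (u : ℤ) ≤ Nat.sqrt m := by exact_mod_cast hu
    have hv' : (v : ℤ) ≤ Nat.sqrt m := by exact_mod_cast hv
    have h0 : (0 : ℤ) ≤ u := by positivity
    have h0' : (0 : ℤ) ≤ v := by positivity
    have := sq_le_sq' (show -(Nat.sqrt m : ℤ) ≤ v - u by linarith) (by linarith)
    linarith
  have bx := bound hv.1 hw.1
  have by' := bound hv.2.1 hw.2.1
  have bz := bound hv.2.2 hw.2.2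
  have hxyz : ((x₂ : ℤ) - x₁ ≠ 0 ∨ (y₂ : ℤ) - y₁ ≠ 0 ∨ (z₂ : ℤ) - z₁ ≠ 0) := by
    by_contra! h
    apply hne
    simp only [Prod.mk.injEq]
    omega
  obtain ⟨x, hx⟩ : ∃ x : ℤ, x = x₂ - x₁ := ⟨_, rfl⟩
  obtain ⟨y, hy⟩ : ∃ y : ℤ, y = y₂ - y₁ := ⟨_, rfl⟩
  obtain ⟨z, hz⟩ : ∃ z : ℤ, z = z₂ - z₁ := ⟨_, rfl⟩
  rw [← hx] at bx hxyz
  rw [← hy] at by' hxyz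
  rw [← hz] at bz hxyz
  replace k1 : (l : ℤ) ∣ b * y - β * z := by
    rw [hy, hz]; convert k1 using 1; ring
  replace k2 : (b : ℤ) ∣ l * x - γ * z := by
    rw [hx, hz]; convert k2 using 1; ring
  replace k3 : (c : ℤ) ∣ l * x - δ * y := by
    rw [hx, hy]; convert k3 using 1; ring
  clear hx hy hz hv hw hne bound hcard F s
  have clb : IsCoprime (l : ℤ) b := Nat.isCoprime_iff_coprime.2 hlb
  have clc : IsCoprime (l : ℤ) c := Nat.isCoprime_iff_coprime.2 hlc
  have cbc : IsCoprime (b : ℤ) c := Nat.isCoprime_iff_coprime.2 hbc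
  have d1 : (l : ℤ) ∣ l * x ^ 2 + b * y ^ 2 - c * z ^ 2 := by
    have : (l : ℤ) ∣ b * (b * y ^ 2 - c * z ^ 2) := by
      have e : (b * (b * y ^ 2 - c * z ^ 2) : ℤ) =
        (b * y - β * z) * (b * y + β * z) + (β ^ 2 - b * c) * z ^ 2 := by ring
      rw [e]; exact dvd_add (k1.mul_right _) (h1.mul_right _)
    have := (clb.dvd_of_dvd_mul_left this)
    have e : (l * x ^ 2 + b * y ^ 2 - c * z ^ 2 : ℤ) = l * x ^ 2 + (b * y ^ 2 - c * z ^ 2) := by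
      ring
    rw [e]; exact dvd_add (Dvd.intro _ rfl) this
  have d2 : (b : ℤ) ∣ l * x ^ 2 + b * y ^ 2 - c * z ^ 2 := by
    have : (b : ℤ) ∣ l * (l * x ^ 2 - c * z ^ 2) := by
      have e : (l * (l * x ^ 2 - c * z ^ 2) : ℤ) =
        (l * x - γ * z) * (l * x + γ * z) + (γ ^ 2 - c * l) * z ^ 2 := by ring
      rw [e]; exact dvd_add (k2.mul_right _) (h2.mul_right _)
    have := (clb.symm.dvd_of_dvd_mul_left this)
    have e : (l * x ^ 2 + b * y ^ 2 - c * z ^ 2 : ℤ) = b * y ^ 2 + (l * x ^ 2 - c * z ^ 2) := by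
      ring
    rw [e]; exact dvd_add (Dvd.intro _ rfl) this
  have d3 : (c : ℤ) ∣ l * x ^ 2 + b * y ^ 2 - c * z ^ 2 := by
    have : (c : ℤ) ∣ l * (l * x ^ 2 + b * y ^ 2) := by
      have e : (l * (l * x ^ 2 + b * y ^ 2) : ℤ) =
        (l * x - δ * y) * (l * x + δ * y) + (δ ^ 2 + l * b) * y ^ 2 := by ring
      rw [e]; exact dvd_add (k3.mul_right _) (h3.mul_right _)
    exact dvd_sub (clc.symm.dvd_of_dvd_mul_left this) (Dvd.intro _ rfl)
  obtain ⟨m, hm⟩ := (IsCoprime.mul_left clc cbc).mul_dvd (clb.mul_dvd d1 d2) d3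
  have pl : (0 : ℤ) < l := by exact_mod_cast hl0
  have pb : (0 : ℤ) < b := by exact_mod_cast hb
  have pc : (0 : ℤ) < c := by exact_mod_cast hc
  push_cast at bx by' bz
  have ax : (l : ℤ) * x ^ 2 ≤ l * b * c := by nlinarith
  have ay : (b : ℤ) * y ^ 2 ≤ l * b * c := by nlinarith
  have az : (c : ℤ) * z ^ 2 ≤ l * b * c := by nlinarith
  have nx : 0 ≤ (l : ℤ) * x ^ 2 := by positivity
  have ny : 0 ≤ (b : ℤ) * y ^ 2 := by positivity
  have nz : 0 ≤ (c : ℤ) * z ^ 2 := by positivity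
  have pos : (0 : ℤ) < l * b * c := by positivity
  have m1 : -1 ≤ m := by nlinarith
  have m2 : m ≤ 2 := by nlinarith
  have hlp : Prime (l : ℤ) := Nat.prime_iff_prime_int.1 hl
  have sq_ne : ∀ {w : ℤ} {d : ℕ}, l.Coprime d → w ^ 2 ≠ l * d := by
    intro w d hd hw
    obtain ⟨v, rfl⟩ : (l : ℤ) ∣ w := hlp.dvd_of_dvd_pow (Dvd.intro _ hw.symm)
    have : (l : ℤ) ∣ d := ⟨v ^ 2, mul_left_cancel₀ pl.ne' (by rw [← hw]; ring)⟩
    exact (Nat.Prime.coprime_iff_not_dvd hl).1 hd (Int.natCast_dvd_natCast.1 this)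
  -- The form equals `m l b c`. The extreme values `m = -1` and `m = 2` force `z² = l b` and `y² = l
  -- c`, where `l` divides the right side exactly once. For `m = 1` an identity multiplying by the
  -- norm `z² + l b` turns the solution into a zero.
  obtain rfl | rfl | rfl | rfl : m = -1 ∨ m = 0 ∨ m = 1 ∨ m = 2 := by omega
  · refine absurd (mul_left_cancel₀ pc.ne' ?_ : z ^ 2 = l * b) (sq_ne hlb)
    linarith
  · exact ⟨x, y, z, hxyz, by linarith⟩
  · refine ⟨b * y + x * z, l * x - y * z, l * b + z ^ 2, Or.inr (Or.inr (by positivity)), ?_⟩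
    have e : (l * x ^ 2 + b * y ^ 2 : ℤ) = c * z ^ 2 + l * b * c := by linarith
    calc (l * (b * y + x * z) ^ 2 + b * (l * x - y * z) ^ 2 : ℤ)
        = (l * b + z ^ 2) * (l * x ^ 2 + b * y ^ 2) := by ring
      _ = _ := by rw [e]; ring
  · refine absurd (mul_left_cancel₀ pb.ne' ?_ : y ^ 2 = l * c) (sq_ne hlc)
    linarith

end PriorityHTP

/-! ### Representation of `1 + p n²` by a ternary form, through an auxiliary prime -/

namespace PriorityHTP

/-- Dirichlet's theorem; the two congruences are compatible because `2r ∣ n` makes `1 + p n²`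
coprime to `8 r p`. The residues are chosen so that quadratic reciprocity makes `r`, `p` and `1 + p
n²` squares modulo `l`. -/
theorem exists_prime_of_residues {p r n : ℕ} (hp : p.Prime) (hr : Odd r) (hn : 2 * r ∣ n) :
    ∃ l : ℕ, l.Prime ∧ r < l ∧ l ≡ 1 [MOD 8 * (r * p)] ∧ l ≡ r [MOD 1 + p * n ^ 2] := by
  obtain ⟨k, rfl⟩ := hn
  have c1 : Nat.Coprime (r * p) (1 + p * (2 * r * k) ^ 2) := by
    have e : 1 + p * (2 * r * k) ^ 2 = 1 + (r * p) * (4 * r * k ^ 2) := by ring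
    rw [e]; simp
  have c2 : Nat.Coprime 2 (1 + p * (2 * r * k) ^ 2) := by
    have e : 1 + p * (2 * r * k) ^ 2 = 1 + 2 * (2 * p * r ^ 2 * k ^ 2) := by ring
    rw [e]; simp
  have c3 : Nat.Coprime (8 * (r * p)) (1 + p * (2 * r * k) ^ 2) :=
    Nat.Coprime.mul_left (by simpa using c2.pow_left 3) c1
  obtain ⟨a, ha1, ha2⟩ := Nat.chineseRemainder c3 1 r
  have hr0 : r ≠ 0 := by rintro rfl; simp at hr
  have hc : a.Coprime (8 * (r * p) * (1 + p * (2 * r * k) ^ 2)) := by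
    refine Nat.Coprime.mul_right ?_ ?_
    · rw [Nat.Coprime, ha1.gcd_eq]; simp
    · rw [Nat.Coprime, ha2.gcd_eq]; exact c1.coprime_dvd_left (Dvd.intro _ rfl)
  obtain ⟨l, hgt, hl, hmod⟩ := Nat.forall_exists_prime_gt_and_modEq r
    (by have := hp.ne_zero; positivity) hc
  exact ⟨l, hl, hgt, (hmod.of_mul_right _).trans ha1, (hmod.of_mul_left _).trans ha2⟩

/-- The values `1 + p n²` are represented, over `ℚ`, by the form `x² - r u² + r p w²`. -/
theorem exists_representation {p r n : ℕ} (hp : p.Prime) (hr : Odd r)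
    (hsq : ¬ IsSquare (r : ℤ)) (hn : 2 * r ∣ n) :
    ∃ Z x u w : ℤ, Z ≠ 0 ∧ Z ^ 2 * (1 + p * n ^ 2) = x ^ 2 - r * u ^ 2 + r * p * w ^ 2 := by
  obtain ⟨l, hl, hrl, h1, h2⟩ := exists_prime_of_residues hp hr hn
  obtain ⟨k, hk⟩ := hn
  have hr0 : 0 < r := hr.pos
  have hp0 := hp.pos
  have : Fact l.Prime := ⟨hl⟩
  obtain ⟨P, hP⟩ : ∃ P, P = 1 + p * n ^ 2 := ⟨_, rfl⟩
  rw [← hP] at h2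
  have l8 : l ≡ 1 [MOD 8] := h1.of_mul_right _
  have l4 : l % 4 = 1 := by have : l % 8 = 1 := l8; omega
  have lodd : Odd l := Nat.odd_iff.2 (by omega)
  have lr : l ≡ 1 [MOD r] := (h1.of_mul_left 8).of_mul_right p
  have lp : l ≡ 1 [MOD p] := (h1.of_mul_left 8).of_mul_left r
  have lrp : l ≡ 1 [MOD r * p] := h1.of_mul_left 8
  have P0 : 0 < P := by omega
  have Prp : P ≡ 1 [MOD r * p] := by
    rw [hP, hk]
    have e : 1 + p * (2 * r * k) ^ 2 = 1 + (r * p) * (4 * r * k ^ 2) := by ring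
    rw [e]; simp [Nat.ModEq]
  have P4 : P % 4 = 1 := by
    rw [hP, hk]
    have e : 1 + p * (2 * r * k) ^ 2 = 1 + 4 * (p * r ^ 2 * k ^ 2) := by ring
    rw [e]; simp
  have Podd : Odd P := Nat.odd_iff.2 (by omega)
  have crp : Nat.Coprime (r * p) P := by
    rw [Nat.coprime_comm, Nat.Coprime, Prp.gcd_eq]; simp
  have clrp : Nat.Coprime l (r * p) := by rw [Nat.Coprime, lrp.gcd_eq]; simp
  have clP : Nat.Coprime l P := by
    rw [Nat.Coprime, h2.gcd_eq]; exact crp.coprime_dvd_left (Dvd.intro _ rfl)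
  have toInt : ∀ {a b m : ℕ}, a ≡ b [MOD m] → (a : ℤ) % m = (b : ℤ) % m := by
    intro a b m h; exact_mod_cast h
  have Jr : jacobiSym r l = 1 := by
    rw [jacobiSym.quadratic_reciprocity_one_mod_four' hr l4, jacobiSym.mod_left' (toInt lr)]
    simp
  have Jp : jacobiSym p l = 1 := by
    rcases hp.eq_two_or_odd' with rfl | hodd
    · have e : ((l : ℕ) : ZMod 8) = 1 := by
        have := (ZMod.natCast_eq_natCast_iff l 1 8).2 l8
        simpa using this
      rw [Nat.cast_ofNat, jacobiSym.at_two lodd, e]; rfl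
    · rw [jacobiSym.quadratic_reciprocity_one_mod_four' hodd l4, jacobiSym.mod_left' (toInt lp)]
      simp
  -- Reciprocity is applied twice: `(P/l) = (l/P) = (r/P) = (P/r) = (1/r) = 1`.
  have JP : jacobiSym P l = 1 := by
    rw [jacobiSym.quadratic_reciprocity_one_mod_four' Podd l4, jacobiSym.mod_left' (toInt h2),
      ← jacobiSym.quadratic_reciprocity_one_mod_four P4 hr,
      jacobiSym.mod_left' (toInt (Prp.of_mul_right p))]
    simp
  have sq_mod : ∀ {a : ℤ}, jacobiSym a l = 1 → ∃ β : ℤ, (l : ℤ) ∣ β ^ 2 - a := by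
    intro a ha
    obtain ⟨y, hy⟩ := ZMod.isSquare_of_jacobiSym_eq_one ha
    obtain ⟨β, rfl⟩ := ZMod.intCast_surjective y
    refine ⟨β, (ZMod.intCast_zmod_eq_zero_iff_dvd _ _).1 ?_⟩
    push_cast
    rw [hy]; ring
  obtain ⟨β, hβ⟩ := sq_mod Jr
  obtain ⟨β', hβ'⟩ := sq_mod (a := r * p * P)
    (by simp only [jacobiSym.mul_left, Jr, Jp, JP, mul_one])
  have dvd_of : ∀ {a b m : ℕ}, a ≡ b [MOD m] → (m : ℤ) ∣ b - a := fun h => Nat.modEq_iff_dvd.1 h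
  -- Two forms are made to share the value `l` up to squares: `l v² = x² - r u²` here, and `l X² = P
  -- Z² - r p W²` next. Eliminating `l` gives the representation; `v ≠ 0` because `r` is not a
  -- square.
  obtain ⟨v, u, x, hne, hE⟩ := exists_zero_ternary (β := β) (γ := 1) (δ := 0) hl hr0 one_pos
    (clrp.coprime_dvd_right (Dvd.intro _ rfl)) (Nat.coprime_one_right l) (Nat.coprime_one_right r)
    (by simpa using hβ) (by simpa using dvd_of lr) (by simp)
  -- The choice `δ = r p n` works because `p n² ≡ -1` and `l ≡ r` modulo `P`.
  obtain ⟨X, W, Z, hne', hE'⟩ := exists_zero_ternary (β := β') (γ := 1) (δ := r * p * n) hl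
    (Nat.mul_pos hr0 hp0) P0 clrp clP crp
    (by push_cast; exact hβ')
    (by have := dvd_of (Prp.mul lrp); push_cast at this ⊢; simpa using this)
    (by
      have e : ((r * p * n) ^ 2 + l * (r * p : ℕ) : ℤ) =
          (r ^ 2 * p) * P - r * p * (r - l) := by
        rw [hP]; push_cast; ring
      rw [e]
      exact dvd_sub (Dvd.intro_left _ rfl) ((dvd_of h2).mul_left _))
  have pl : (0 : ℤ) < l := by exact_mod_cast hl.pos
  have pr : (0 : ℤ) < r := by exact_mod_cast hr0
  have pp : (0 : ℤ) < p := by exact_mod_cast hp0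
  have hv : v ≠ 0 := by
    rintro rfl
    have hu : u ≠ 0 := by
      rintro rfl
      simp at hE hne
      exact hne (pow_eq_zero_iff two_ne_zero |>.1 hE.symm)
    apply hsq
    have hE2 : (r : ℤ) * u ^ 2 = x ^ 2 := by simpa using hE
    obtain ⟨t, rfl⟩ : u ∣ x := (Int.pow_dvd_pow_iff two_ne_zero).1 (Dvd.intro_left _ hE2)
    refine ⟨t, mul_right_cancel₀ (pow_ne_zero 2 hu) (hE2.trans (by ring))⟩
  have hZ : Z ≠ 0 := by
    rintro rfl
    have e1 : (0 : ℤ) ≤ l * X ^ 2 := by positivity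
    have e2 : (0 : ℤ) ≤ (r * p : ℕ) * W ^ 2 := by positivity
    have z1 : (l : ℤ) * X ^ 2 = 0 := by simp at hE'; push_cast at *; linarith
    have z2 : ((r * p : ℕ) : ℤ) * W ^ 2 = 0 := by simp at hE'; push_cast at *; linarith
    simp [hl.ne_zero, hr0.ne', hp0.ne'] at z1 z2
    simp [z1, z2] at hne'
  refine ⟨Z * v, x * X, u * X, W * v, mul_ne_zero hZ hv, ?_⟩
  have hP' : (1 + p * n ^ 2 : ℤ) = P := by rw [hP]; push_cast; ring
  push_cast at hE hE'
  rw [hP']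
  linear_combination (-v ^ 2) * hE' + X ^ 2 * hE

end PriorityHTP

/-! ### Anisotropy of the quaternion norm form at `p` -/

namespace PriorityHTP

/-- The condition on `r` that makes `x² - r u² - p t² + r p w²` anisotropic over `ℚ_p`. -/
def IsNonresidue (p r : ℕ) : Prop :=
  Odd r ∧ if p = 2 then r % 8 = 5 else ∀ y < p, y ^ 2 % p ≠ r % p

theorem IsNonresidue.not_dvd {p r : ℕ} (hp : p.Prime) (h : IsNonresidue p r) : ¬ p ∣ r := by
  intro hd
  by_cases h2 : p = 2
  · subst h2
    exact (Nat.not_even_iff_odd.2 h.1) (even_iff_two_dvd.2 hd)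
  · have := h.2
    rw [if_neg h2] at this
    exact this 0 hp.pos (by simp [Nat.mod_eq_zero_of_dvd hd])

theorem IsNonresidue.not_dvd_sub {p r : ℕ} (hp : p.Prime) (h2 : p ≠ 2) (h : IsNonresidue p r)
    (y : ℤ) : ¬ (p : ℤ) ∣ y ^ 2 - r := by
  intro hd
  have h' := h.2
  rw [if_neg h2] at h'
  have hp0 : (0 : ℤ) < p := by exact_mod_cast hp.pos
  obtain ⟨k, hk⟩ := Int.eq_ofNat_of_zero_le (Int.emod_nonneg y hp0.ne')
  have hlt := Int.emod_lt_of_pos y hp0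
  rw [hk] at hlt
  refine h' k (by exact_mod_cast hlt) ?_
  have e : ((k : ℤ) ^ 2) % p = r % p := by
    have e1 := Int.emod_emod_of_dvd y (dvd_refl (p : ℤ))
    have : (k : ℤ) ≡ y [ZMOD p] := by
      have : (k : ℤ) = y % p := hk.symm
      rw [this]; exact Int.mod_modEq _ _
    exact (this.pow 2).trans (Int.modEq_iff_dvd.2 (by
      have := dvd_neg.2 hd; simpa using this))
  exact_mod_cast e

theorem IsNonresidue.not_isSquare {p r : ℕ} (hp : p.Prime) (h : IsNonresidue p r) :
    ¬ IsSquare (r : ℤ) := by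
  rintro ⟨y, hy⟩
  by_cases h2 : p = 2
  · have h' := h.2
    rw [if_pos h2] at h'
    have h8 : (y * y) % 8 = 5 := by rw [← hy]; exact_mod_cast h'
    have : y % 8 = 0 ∨ y % 8 = 1 ∨ y % 8 = 2 ∨ y % 8 = 3 ∨ y % 8 = 4 ∨ y % 8 = 5 ∨ y % 8 = 6 ∨
        y % 8 = 7 := by omega
    rcases this with e | e | e | e | e | e | e | e <;> simp [Int.mul_emod, e] at h8
  · exact h.not_dvd_sub hp h2 y (by rw [hy, sq]; simp)

/-- For odd `p`, a nonsquare class has the representatives `a` and `a + p` with `a < p`, and one of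
them is odd. The explicit bound is what later lets `nonresidue` be computed by bounded search. -/
theorem exists_isNonresidue {p : ℕ} (hp : p.Prime) : ∃ r ≤ 2 * p + 5, IsNonresidue p r := by
  by_cases h2 : p = 2
  · exact ⟨5, by omega, by decide, by simp [h2]⟩
  have hpo : Odd p := hp.odd_of_ne_two h2
  have : Fact p.Prime := ⟨hp⟩
  obtain ⟨a, ha⟩ := FiniteField.exists_nonsquare (F := ZMod p) (by rwa [ZMod.ringChar_zmod_n])
  have key : ∀ r : ℕ, (r : ZMod p) = a → ∀ y < p, y ^ 2 % p ≠ r % p := by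
    intro r hr y _ he
    apply ha
    refine ⟨y, ?_⟩
    have := (ZMod.natCast_eq_natCast_iff' _ _ p).2 he
    rw [← hr, ← this]; push_cast; ring
  have hlt := ZMod.val_lt a
  rcases Nat.even_or_odd a.val with he | ho
  · exact ⟨a.val + p, by omega, he.add_odd hpo, by rw [if_neg h2]; exact key _ (by simp)⟩
  · exact ⟨a.val, by omega, ho, by rw [if_neg h2]; exact key _ (by simp)⟩

section anisotropy

variable {p r : ℕ}

/-- If `p` did not divide `u`, then `x / u` would be a square root of `r` modulo `p`. -/
theorem IsNonresidue.dvd_of_dvd_norm (hp : p.Prime) (h2 : p ≠ 2) (h : IsNonresidue p r)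
    {x u : ℤ} (hd : (p : ℤ) ∣ x ^ 2 - r * u ^ 2) : (p : ℤ) ∣ x ∧ (p : ℤ) ∣ u := by
  have hpp : Prime (p : ℤ) := Nat.prime_iff_prime_int.1 hp
  have hu : (p : ℤ) ∣ u := by
    by_contra hu
    obtain ⟨a, b, hab⟩ : IsCoprime (u : ℤ) p :=
      ((Int.prime_iff_natAbs_prime.2 (by simpa using hp)).coprime_iff_not_dvd.2 hu).symm
    refine h.not_dvd_sub hp h2 (x * a) ?_
    have e : (x * a) ^ 2 - r = (x ^ 2 - r * u ^ 2) * a ^ 2 + p * (r * (-b) * (a * u + 1)) := by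
      have : b * p = 1 - a * u := by linarith
      linear_combination (r * (a * u + 1)) * this
    rw [e]; exact dvd_add (hd.mul_right _) (Dvd.intro _ rfl)
  refine ⟨hpp.dvd_of_dvd_pow (n := 2) ?_, hu⟩
  have : (p : ℤ) ∣ r * u ^ 2 := (hu.pow two_ne_zero).mul_left _
  simpa using dvd_add hd this

/-- Descent: modulo `p` the equation makes the norm `X² - r U²` vanish, so `p` divides `X` and `U`;
after division by `p` the same holds for `T² - r W²`, and the whole equation can be divided by `p²`.
-/
theorem IsNonresidue.pow_dvd (hp : p.Prime) (h2 : p ≠ 2) (h : IsNonresidue p r) (k : ℕ) :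
    ∀ {Z T X U W : ℤ}, Z ^ 2 + p * T ^ 2 = X ^ 2 - r * U ^ 2 + r * p * W ^ 2 →
      (p : ℤ) ^ k ∣ Z → (p : ℤ) ^ k ∣ T := by
  induction k with
  | zero => simp
  | succ k ih =>
    intro Z T X U W e hZ
    have hp0 : (p : ℤ) ≠ 0 := by exact_mod_cast hp.ne_zero
    obtain ⟨Z, rfl⟩ : (p : ℤ) ∣ Z := (dvd_pow_self _ k.succ_ne_zero).trans hZ
    obtain ⟨⟨X, rfl⟩, ⟨U, rfl⟩⟩ := h.dvd_of_dvd_norm hp h2 (x := X) (u := U)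
      ⟨p * Z ^ 2 + T ^ 2 - r * W ^ 2, by linear_combination -e⟩
    obtain ⟨⟨T, rfl⟩, ⟨W, rfl⟩⟩ := h.dvd_of_dvd_norm hp h2 (x := T) (u := W)
      ⟨X ^ 2 - r * U ^ 2 - Z ^ 2, mul_left_cancel₀ hp0 (by linear_combination e)⟩
    rw [pow_succ'] at hZ ⊢
    refine mul_dvd_mul_left _ (ih (Z := Z) (X := X) (U := U) (W := W) ?_
      ((mul_dvd_mul_iff_left hp0).1 hZ))
    exact mul_left_cancel₀ (pow_ne_zero 2 hp0) (by linear_combination e)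

theorem even_and_sq_or_odd_and_sq (x : ℤ) :
    (∃ y, x = 2 * y) ∨ x ^ 2 % 8 = 1 := by
  rcases Int.even_or_odd' x with ⟨k, rfl | rfl⟩
  · exact Or.inl ⟨k, rfl⟩
  · right
    have : k % 2 = 0 ∨ k % 2 = 1 := by omega
    obtain ⟨m, hm⟩ := Int.even_mul_succ_self k
    have : (2 * k + 1) ^ 2 = 8 * m + 1 := by linear_combination 4 * hm
    omega

/-- If the norm `x² - r u²` is even, with `r ≡ 5` modulo 8, then `x` and `u` are even or the norm
is 4 modulo 8. -/
theorem even_of_even_norm {r x u : ℤ} (hr : r % 8 = 5) (h : (x ^ 2 - r * u ^ 2) % 2 = 0) :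
    (∃ y v, x = 2 * y ∧ u = 2 * v) ∨ (x ^ 2 - r * u ^ 2) % 8 = 4 := by
  obtain ⟨s, rfl⟩ : ∃ s, r = 8 * s + 5 := ⟨r / 8, by omega⟩
  rcases even_and_sq_or_odd_and_sq x with ⟨y, rfl⟩ | hx <;>
    rcases even_and_sq_or_odd_and_sq u with ⟨v, rfl⟩ | hu
  · exact Or.inl ⟨y, v, rfl, rfl⟩
  · exfalso
    obtain ⟨a, ha⟩ : ∃ a, u ^ 2 = 8 * a + 1 := ⟨u ^ 2 / 8, by omega⟩
    rw [ha] at h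
    ring_nf at h
    omega
  · exfalso
    obtain ⟨a, ha⟩ : ∃ a, x ^ 2 = 8 * a + 1 := ⟨x ^ 2 / 8, by omega⟩
    rw [ha] at h
    ring_nf at h
    omega
  · right
    obtain ⟨a, ha⟩ : ∃ a, u ^ 2 = 8 * a + 1 := ⟨u ^ 2 / 8, by omega⟩
    obtain ⟨b, hb⟩ : ∃ b, x ^ 2 = 8 * b + 1 := ⟨x ^ 2 / 8, by omega⟩
    rw [ha, hb]
    ring_nf
    omega

/-- The same descent at 2: an even norm is divisible by 4, which excludes the cases where the norms
of `(X, U)` and `(T, W)` would differ by a single factor 2. One factor 2 is lost, since `ℤ_2[√r]`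
has index 2 in its integral closure and an even norm need not come from even `x` and `u`. -/
theorem two_pow_dvd {r : ℤ} (hr : r % 8 = 5) (k : ℕ) :
    ∀ {Z T X U W : ℤ}, Z ^ 2 + 2 * T ^ 2 = X ^ 2 - r * U ^ 2 + r * 2 * W ^ 2 →
      (2 : ℤ) ^ (k + 1) ∣ Z → (2 : ℤ) ^ k ∣ T := by
  induction k with
  | zero => simp
  | succ k ih =>
    intro Z T X U W e hZ
    obtain ⟨z, rfl⟩ : (4 : ℤ) ∣ Z := by
      refine (show (4 : ℤ) ∣ 2 ^ (k + 1 + 1) from ⟨2 ^ k, by ring⟩).trans hZ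
    have e1 : X ^ 2 - r * U ^ 2 = 16 * z ^ 2 + 2 * (T ^ 2 - r * W ^ 2) := by linear_combination -e
    rcases even_of_even_norm (x := X) (u := U) hr (by rw [e1]; omega) with
      ⟨X, U, rfl, rfl⟩ | h4
    · rcases even_of_even_norm (x := T) (u := W) hr (by
        have : T ^ 2 - r * W ^ 2 = 2 * (X ^ 2 - r * U ^ 2 - 4 * z ^ 2) := by linarith
        omega) with ⟨T, W, rfl, rfl⟩ | h4
      · rw [pow_succ'] at hZ ⊢
        refine mul_dvd_mul_left _ (ih (Z := 2 * z) (X := X) (U := U) (W := W) ?_ ?_)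
        · linarith
        · have : (4 * z : ℤ) = 2 * (2 * z) := by ring
          rw [this] at hZ
          exact (mul_dvd_mul_iff_left two_ne_zero).1 hZ
      · exfalso
        have e2 : T ^ 2 - r * W ^ 2 = 2 * (X ^ 2 - r * U ^ 2 - 4 * z ^ 2) := by linarith
        have h2 : (X ^ 2 - r * U ^ 2) % 4 = 2 := by omega
        rcases even_of_even_norm (x := X) (u := U) hr (by omega) with ⟨x, u, rfl, rfl⟩ | h
        · ring_nf at h2; omega
        · omega
    · exfalso
      have h2 : (T ^ 2 - r * W ^ 2) % 4 = 2 := by omega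
      rcases even_of_even_norm (x := T) (u := W) hr (by omega) with ⟨x, u, rfl, rfl⟩ | h
      · ring_nf at h2; omega
      · omega

end anisotropy

end PriorityHTP

namespace PriorityHTP

/-! ### Denominators -/

theorem mem_ringInv {S : Set ℕ} (hS : ∀ p ∈ S, p.Prime) {a : ℚ} :
    a ∈ ringInv S ↔ ∀ p : ℕ, p.Prime → p ∣ a.den → p ∈ S := by
  constructor
  · intro h
    induction h using Subring.closure_induction with
    | mem x hx =>
      obtain ⟨q, hq, rfl⟩ := hx
      intro p hp hd
      have : ((q : ℚ)⁻¹).den = q := by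
        exact Rat.inv_natCast_den_of_pos (hS q hq).pos
      simp only [this] at hd
      rwa [(Nat.prime_dvd_prime_iff_eq hp (hS q hq)).1 hd]
    | zero => intro p hp hd; exact absurd hd (by simpa using hp.one_lt.ne')
    | one => intro p hp hd; exact absurd hd (by simpa using hp.one_lt.ne')
    | add x y _ _ hx hy =>
      intro p hp hd
      rcases hp.dvd_mul.1 (hd.trans (Rat.add_den_dvd x y)) with h | h
      exacts [hx p hp h, hy p hp h]
    | neg x _ hx => simpa using hx
    | mul x y _ _ hx hy =>
      intro p hp hd
      rcases hp.dvd_mul.1 (hd.trans (Rat.mul_den_dvd x y)) with h | h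
      exacts [hx p hp h, hy p hp h]
  · intro h
    have key : ∀ n : ℕ, n ≠ 0 → (∀ p : ℕ, p.Prime → p ∣ n → p ∈ S) →
        (n : ℚ)⁻¹ ∈ ringInv S := by
      intro n
      induction n using Nat.recOnMul with
      | zero => simp
      | one => intros; simp [one_mem]
      | prime p hp =>
        intro _ h
        exact Subring.subset_closure ⟨p, h p hp dvd_rfl, rfl⟩
      | mul a b ha hb =>
        intro h0 h
        rw [Nat.cast_mul, mul_inv]
        exact mul_mem (ha (left_ne_zero_of_mul h0) fun p hp hd => h p hp (hd.mul_right b))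
          (hb (right_ne_zero_of_mul h0) fun p hp hd => h p hp (hd.mul_left a))
    rw [← Rat.num_div_den a, div_eq_mul_inv]
    exact mul_mem (intCast_mem _ _) (key _ a.den_ne_zero h)

/-- The local ring of the rational numbers whose denominator is prime to `p`. -/
def localRing (p : ℕ) : Subring ℚ := ringInv {q | q.Prime ∧ q ≠ p}

theorem mem_localRing {p : ℕ} (hp : p.Prime) {a : ℚ} : a ∈ localRing p ↔ ¬ p ∣ a.den := by
  rw [localRing, mem_ringInv fun q hq => hq.1]
  constructor
  · exact fun h hd => (h p hp hd).2 rfl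
  · rintro h q hq hd
    exact ⟨hq, fun e => h (e ▸ hd)⟩

theorem mem_ringInv_diff {M V : Set ℕ} (hM : ∀ p ∈ M, p.Prime) (hV : ∀ p ∈ V, p.Prime) {a : ℚ} :
    a ∈ ringInv (M \ V) ↔ a ∈ ringInv M ∧ ∀ p ∈ V, a ∈ localRing p := by
  rw [mem_ringInv fun p hp => hM p hp.1, mem_ringInv hM]
  constructor
  · intro h
    exact ⟨fun p hp hd => (h p hp hd).1,
      fun p hp => (mem_localRing (hV p hp)).2 fun hd => (h p (hV p hp) hd).2 hp⟩
  · rintro ⟨h1, h2⟩ p hp hd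
    exact ⟨h1 p hp hd, fun h => (mem_localRing hp).1 (h2 p h) hd⟩

theorem mem_localRing_of_mul_eq {p : ℕ} (hp : p.Prime) {a : ℚ} {m n : ℤ} (hn : ¬ (p : ℤ) ∣ n)
    (h : a * n = m) : a ∈ localRing p := by
  rw [mem_localRing hp]
  intro hd
  have e : a.num * n = m * a.den := by
    have : (a.num : ℚ) = a * a.den := (Rat.mul_den_eq_num a).symm
    have : (a.num * n : ℚ) = m * a.den := by rw [this, ← h]; ring
    exact_mod_cast this
  have hpp : Prime (p : ℤ) := Nat.prime_iff_prime_int.1 hp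
  rcases hpp.dvd_or_dvd (e ▸ (Int.natCast_dvd_natCast.2 hd).mul_left m) with h1 | h1
  · have h2 := Nat.dvd_gcd (Int.natCast_dvd.1 h1) hd
    rw [a.reduced] at h2
    exact hp.one_lt.ne' (Nat.dvd_one.1 h2)
  · exact hn h1

theorem exists_mul_eq_of_mem_localRing {p : ℕ} (hp : p.Prime) {a : ℚ} (h : a ∈ localRing p) :
    ∃ m n : ℤ, ¬ (p : ℤ) ∣ n ∧ a * n = m :=
  ⟨a.num, a.den, fun hd => (mem_localRing hp).1 h (Int.natCast_dvd_natCast.1 hd),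
    by exact_mod_cast Rat.mul_den_eq_num a⟩

theorem mem_localRing_of_mul_mem {p : ℕ} (hp : p.Prime) {a : ℚ} {n : ℤ} (hn : ¬ (p : ℤ) ∣ n)
    (h : a * n ∈ localRing p) : a ∈ localRing p := by
  obtain ⟨k, l, hl, e⟩ := exists_mul_eq_of_mem_localRing hp h
  refine mem_localRing_of_mul_eq hp (m := k) (n := n * l) ?_ (by push_cast; rw [← e]; ring)
  intro hd
  rcases (Nat.prime_iff_prime_int.1 hp).dvd_or_dvd hd with h | h
  exacts [hn h, hl h]

/-- The polynomial is monic: a factor `p` in the denominator of `y` survives in every linear factor,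
whose numerators remain prime to `p`. -/
theorem mem_localRing_of_poly_mem {p : ℕ} (hp : p.Prime) {y : ℚ}
    (h : y * (y - 1) * (y - 2) * (y - 3) ∈ localRing p) : y ∈ localRing p := by
  rw [mem_localRing hp]
  intro hd
  obtain ⟨k, l, hl, e⟩ := exists_mul_eq_of_mem_localRing hp h
  have hpp : Prime (p : ℤ) := Nat.prime_iff_prime_int.1 hp
  have hd' : (p : ℤ) ∣ y.den := Int.natCast_dvd_natCast.2 hd
  have hn : ¬ (p : ℤ) ∣ y.num := by
    intro h1
    have h2 := Nat.dvd_gcd (Int.natCast_dvd.1 h1) hd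
    rw [y.reduced] at h2
    exact hp.one_lt.ne' (Nat.dvd_one.1 h2)
  have e' : y.num * (y.num - y.den) * (y.num - 2 * y.den) * (y.num - 3 * y.den) * l
      = k * y.den ^ 4 := by
    have : (y.num : ℚ) = y * y.den := (Rat.mul_den_eq_num y).symm
    have : (y.num * (y.num - y.den) * (y.num - 2 * y.den) * (y.num - 3 * y.den) * l : ℚ)
      = k * y.den ^ 4 := by rw [this, ← e]; ring
    exact_mod_cast this
  have hdvd : (p : ℤ) ∣ y.num * (y.num - y.den) * (y.num - 2 * y.den) * (y.num - 3 * y.den) * l :=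
    e' ▸ (hd'.pow four_ne_zero).mul_left k
  have aux : ∀ c : ℤ, ¬ (p : ℤ) ∣ y.num - c * y.den := by
    intro c hc
    exact hn (by simpa using dvd_add hc (hd'.mul_left c))
  rcases hpp.dvd_or_dvd hdvd with h | h
  · rcases hpp.dvd_or_dvd h with h | h
    · rcases hpp.dvd_or_dvd h with h | h
      · rcases hpp.dvd_or_dvd h with h | h
        · exact hn h
        · exact aux 1 (by simpa using h)
      · exact aux 2 h
    · exact aux 3 h
  · exact hl h

/-! ### An existential definition of the local ring -/

/-- After clearing denominators the descent applies to `2Z` and `T = Z q`: the exact power of `p` in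
`Z` divides `Z q`, hence cancels from `q`. The constant 4, rather than 1, turns `Z` into `2Z` and
provides the extra factor 2 demanded by `two_pow_dvd`. -/
theorem mem_localRing_of_representation {p r : ℕ} (hp : p.Prime) (hr : IsNonresidue p r)
    {Z q x u w : ℚ} (hZ : Z ≠ 0)
    (h : Z ^ 2 * (4 + p * q ^ 2) = x ^ 2 - r * u ^ 2 + r * p * w ^ 2) : q ∈ localRing p := by
  obtain ⟨D, hD, Zi, Ti, xi, ui, wi, e1, e2, e3, e4, e5⟩ : ∃ D : ℚ, D ≠ 0 ∧ ∃ Zi Ti xi ui wi : ℤ,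
      Z * D = Zi ∧ Z * q * D = Ti ∧ x * D = xi ∧ u * D = ui ∧ w * D = wi := by
    refine ⟨Z.den * (Z * q).den * x.den * u.den * w.den, by positivity,
      Z.num * (Z * q).den * x.den * u.den * w.den, (Z * q).num * Z.den * x.den * u.den * w.den,
      x.num * Z.den * (Z * q).den * u.den * w.den, u.num * Z.den * (Z * q).den * x.den * w.den,
      w.num * Z.den * (Z * q).den * x.den * u.den, ?_, ?_, ?_, ?_, ?_⟩ <;> push_cast
    · rw [← Rat.mul_den_eq_num Z]; ring
    · rw [← Rat.mul_den_eq_num (Z * q)]; ring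
    · rw [← Rat.mul_den_eq_num x]; ring
    · rw [← Rat.mul_den_eq_num u]; ring
    · rw [← Rat.mul_den_eq_num w]; ring
  have hZi : Zi ≠ 0 := by
    rintro rfl
    exact mul_ne_zero hZ hD (by simpa using e1)
  have E : (2 * Zi) ^ 2 + p * Ti ^ 2 = xi ^ 2 - r * ui ^ 2 + r * p * wi ^ 2 := by
    have : ((2 * Zi) ^ 2 + p * Ti ^ 2 : ℚ) = xi ^ 2 - r * ui ^ 2 + r * p * wi ^ 2 := by
      rw [← e1, ← e2, ← e3, ← e4, ← e5]
      linear_combination D ^ 2 * h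
    exact_mod_cast this
  have hfin : FiniteMultiplicity (p : ℤ) Zi :=
    Int.finiteMultiplicity_iff.2 ⟨by simpa using hp.one_lt.ne', hZi⟩
  obtain ⟨m, hm, hpm⟩ := hfin.exists_eq_pow_mul_and_not_dvd
  generalize multiplicity (p : ℤ) Zi = k at hm
  have hT : (p : ℤ) ^ k ∣ Ti := by
    by_cases h2 : p = 2
    · have h8 := hr.2
      rw [if_pos h2] at h8
      subst h2
      exact two_pow_dvd (r := r) (by omega) k (by exact_mod_cast E)
        (by rw [hm]; exact ⟨m, by push_cast; ring⟩)
    · exact hr.pow_dvd hp h2 k E (by rw [hm]; exact ⟨2 * m, by ring⟩)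
  obtain ⟨t, rfl⟩ := hT
  refine mem_localRing_of_mul_eq hp (m := t) hpm ?_
  have hp0 : (p : ℚ) ^ k ≠ 0 := pow_ne_zero _ (by exact_mod_cast hp.ne_zero)
  have : (Zi : ℚ) = p ^ k * m := by exact_mod_cast hm
  apply mul_left_cancel₀ hp0
  push_cast at e2
  rw [← e2, mul_left_comm, ← this, ← e1]
  ring

/-- The polynomial in `y` and the auxiliary `v i` whose zeros certify that `y` is in `ℤ_(p)`. -/
def certificate {A : Type*} [CommRing A] (p r y : A) (v : ℕ → A) : A :=
  (1 + v 0 ^ 2 + v 1 ^ 2 + v 2 ^ 2 + v 3 ^ 2) ^ 2 *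
    (4 + p * (r * (y * (y - 1) * (y - 2) * (y - 3))) ^ 2) -
    (v 4 ^ 2 - r * v 5 ^ 2 + r * p * v 6 ^ 2)

theorem map_certificate {A B : Type*} [CommRing A] [CommRing B] (φ : A →+* B) (p r y : A)
    (v : ℕ → A) :
    φ (certificate p r y v) = certificate (φ p) (φ r) (φ y) (fun i => φ (v i)) := by
  simp [certificate, map_ofNat φ]

/-- The multiplier `1 + v 0 ^ 2 + ⋯ + v 3 ^ 2` cannot vanish on `ℚ`, so a zero is a genuine
representation. The factor `r` is a unit at `p` and can be removed. -/
theorem mem_localRing_of_certificate {p r : ℕ} (hp : p.Prime) (hr : IsNonresidue p r) {y : ℚ}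
    {v : ℕ → ℚ} (h : certificate (p : ℚ) r y v = 0) : y ∈ localRing p := by
  have h1 := mem_localRing_of_representation hp hr
    (by positivity : 1 + v 0 ^ 2 + v 1 ^ 2 + v 2 ^ 2 + v 3 ^ 2 ≠ 0) (sub_eq_zero.1 h)
  refine mem_localRing_of_poly_mem hp (mem_localRing_of_mul_mem hp (n := r) ?_ ?_)
  · exact fun hd => hr.not_dvd hp (Int.natCast_dvd_natCast.1 hd)
  · rw [mul_comm]; exact_mod_cast h1

/-- A product of four consecutive integers is of the form `4m`, so the quantity squared in the
certificate is `4 r m = 2n` with `2r ∣ n`, and `4 + p (2n)² = 4 (1 + p n²)` is represented. By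
Lagrange's theorem the multiplier `|Z| ≥ 1` is 1 plus four squares. All witnesses are integers. -/
theorem exists_certificate {p r : ℕ} (hp : p.Prime) (hr : IsNonresidue p r) (y : ℤ) :
    ∃ v : ℕ → ℤ, certificate (p : ℤ) r y v = 0 := by
  obtain ⟨m, hm⟩ : (4 : ℤ) ∣ y * (y - 1) * (y - 2) * (y - 3) := by
    obtain ⟨a, ha⟩ := Int.even_mul_pred_self y
    obtain ⟨b, hb⟩ := Int.even_mul_pred_self (y - 2)
    exact ⟨a * b, by
      have : y * (y - 1) * (y - 2) * (y - 3) = (y * (y - 1)) * ((y - 2) * (y - 2 - 1)) := by ring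
      rw [this, ha, hb]; ring⟩
  obtain ⟨Z, x, u, w, hZ, e⟩ := exists_representation (n := 2 * r * m.natAbs) hp hr.1
    (hr.not_isSquare hp) (Dvd.intro _ rfl)
  obtain ⟨a, b, c, d, hs⟩ := Nat.sum_four_squares (Z.natAbs - 1)
  have hZ1 : 1 ≤ Z.natAbs := Int.natAbs_pos.2 hZ
  have hs' : (1 + a ^ 2 + b ^ 2 + c ^ 2 + d ^ 2 : ℤ) = Z.natAbs := by
    have : 1 + a ^ 2 + b ^ 2 + c ^ 2 + d ^ 2 = Z.natAbs := by omega
    exact_mod_cast this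
  refine ⟨fun i => [(a : ℤ), b, c, d, 2 * x, 2 * u, 2 * w].getD i 0, ?_⟩
  simp only [certificate, List.getD_cons_zero, List.getD_cons_succ]
  rw [hs', hm, Int.natCast_natAbs, sq_abs]
  push_cast at e
  have e3 : (|m| : ℤ) ^ 2 = m ^ 2 := sq_abs m
  rw [mul_pow, e3] at e
  linear_combination 4 * e

/-- The polynomial in `F`, `x` and the auxiliary `v i` whose zeros certify that `F = 0` and that
`x` is in `ℤ_(p)`. -/
def conjunction {A : Type*} [CommRing A] (p r F x : A) (v : ℕ → A) : A :=
  F ^ 2 + certificate p r (v 0) (fun i => v (i + 1)) ^ 2 +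
    certificate p r (x * (1 + p * v 0)) (fun i => v (i + 8)) ^ 2

theorem map_conjunction {A B : Type*} [CommRing A] [CommRing B] (φ : A →+* B) (p r F x : A)
    (v : ℕ → A) :
    φ (conjunction p r F x v) = conjunction (φ p) (φ r) (φ F) (φ x) (fun i => φ (v i)) := by
  simp [conjunction, map_certificate]

theorem conjunction_congr {A : Type*} [CommRing A] (p r F x : A) {v v' : ℕ → A}
    (h : ∀ i < 15, v i = v' i) : conjunction p r F x v = conjunction p r F x v' := by
  simp [conjunction, certificate, h]

/-- A sum of rational squares vanishes only termwise. Then `v 0` and `x (1 + p v 0)` are integral at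
`p`, and `1 + p v 0` is a unit there. -/
theorem of_conjunction_eq_zero {p r : ℕ} (hp : p.Prime) (hr : IsNonresidue p r) {F x : ℚ}
    {v : ℕ → ℚ} (h : conjunction (p : ℚ) r F x v = 0) : F = 0 ∧ x ∈ localRing p := by
  obtain ⟨h1, h3⟩ := (add_eq_zero_iff_of_nonneg (by positivity) (by positivity)).1 h
  obtain ⟨h1, h2⟩ := (add_eq_zero_iff_of_nonneg (by positivity) (by positivity)).1 h1
  rw [pow_eq_zero_iff two_ne_zero] at h1 h2 h3
  refine ⟨h1, ?_⟩
  obtain ⟨m, n, hn, e⟩ := exists_mul_eq_of_mem_localRing hp (mem_localRing_of_certificate hp hr h2)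
  obtain ⟨m', n', hn', e'⟩ :=
    exists_mul_eq_of_mem_localRing hp (mem_localRing_of_certificate hp hr h3)
  have hpp : Prime (p : ℤ) := Nat.prime_iff_prime_int.1 hp
  refine mem_localRing_of_mul_eq hp (m := m' * n) (n := n' * (n + p * m)) ?_ ?_
  · intro hd
    rcases hpp.dvd_or_dvd hd with hd | hd
    · exact hn' hd
    · exact hn ((dvd_add_left (Dvd.intro _ rfl)).1 hd)
  · push_cast
    rw [← e', ← e]
    ring

/-- Certificates are available for integers only. For `x = m / n` with `p ∤ n`, a Bézout relation
gives an integer `v 0` with `1 + p v 0 = n b`, and then `x (1 + p v 0) = m b` is an integer as well.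
-/
theorem exists_conjunction_eq_zero {p r : ℕ} (hp : p.Prime) (hr : IsNonresidue p r) {x : ℚ}
    (hx : x ∈ localRing p) :
    ∃ v : ℕ → ℤ, conjunction (p : ℚ) r 0 x (fun i => v i) = 0 := by
  obtain ⟨m, n, hn, e⟩ := exists_mul_eq_of_mem_localRing hp hx
  obtain ⟨a, b, hab⟩ : IsCoprime (p : ℤ) n :=
    (Int.prime_iff_natAbs_prime.2 (by simpa using hp)).coprime_iff_not_dvd.2 hn
  obtain ⟨v, hv⟩ := exists_certificate hp hr (-a)
  obtain ⟨v', hv'⟩ := exists_certificate hp hr (m * b)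
  -- Layout of the 15 witnesses: the multiplier at index 0, the first certificate at 1 to 7, the
  -- second at 8 to 14.
  refine ⟨fun i => if i = 0 then -a else if i < 8 then v (i - 1) else v' (i - 8), ?_⟩
  have e1 : x * (1 + p * ((-a : ℤ) : ℚ)) = ((m * b : ℤ) : ℚ) := by
    have : (1 + p * (-a) : ℤ) = n * b := by linarith
    have : (1 + p * (-a) : ℚ) = n * b := by exact_mod_cast this
    push_cast
    rw [this, ← mul_assoc, e]
  have h1 := congrArg (Int.castRingHom ℚ) hv
  have h2 := congrArg (Int.castRingHom ℚ) hv'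
  rw [map_certificate] at h1 h2
  simp only [eq_intCast, Int.cast_natCast, Int.cast_zero] at h1 h2
  simp only [conjunction, if_true, e1]
  simp only [certificate] at h1 h2 ⊢
  simp only [Nat.reduceAdd, Nat.reduceSub, Nat.reduceLT, if_true, if_false,
    OfNat.ofNat_ne_zero, one_ne_zero]
  rw [h1, h2]
  simp

end PriorityHTP

namespace PriorityHTP

/-! ### Eliminating local conditions -/

open MvPolynomial in
theorem aeval_eq_of_agree {N : ℕ} {F : Poly} (hF : F ∈ supported ℤ {j | j < N})
    {x y : ℕ → ℚ} (h : ∀ j < N, x j = y j) : aeval x F = aeval y F := by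
  rw [mem_supported] at hF
  exact eval₂Hom_congr' rfl (fun i hi _ => h i (hF hi)) rfl

/-- The rational zeros of `F` with coordinates in `A` that satisfy `P`. -/
def HasRootWith (A : Subring ℚ) (F : Poly) (P : (ℕ → ℚ) → Prop) : Prop :=
  ∃ x : ℕ → ℚ, (∀ i, x i ∈ A) ∧ MvPolynomial.aeval x F = 0 ∧ P x

open MvPolynomial in
/-- The polynomial which adds to `F = 0` the condition `X i ∈ ℤ_(p)`, by means of 15 new
variables `X N, X (N+1), …`. -/
noncomputable def addCondition (N p r i : ℕ) (F : Poly) : Poly :=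
  conjunction (C (p : ℤ)) (C (r : ℤ)) F (X i) (fun j => X (N + j))

open MvPolynomial in
theorem aeval_addCondition {N p r i : ℕ} {F : Poly} (x : ℕ → ℚ) :
    aeval x (addCondition N p r i F) =
      conjunction (p : ℚ) r (aeval x F) (x i) (fun j => x (N + j)) := by
  have := map_conjunction (aeval (R := ℤ) x).toRingHom (C (p : ℤ)) (C (r : ℤ)) F (X i)
    (fun j => X (N + j))
  simpa [addCondition] using this

open MvPolynomial in
-- The same expression is formed inside the subalgebra of polynomials in the first `N + 15`
-- variables, so no variables have to be counted.
theorem addCondition_mem_supported {N p r i : ℕ} {F : Poly} (hi : i < N)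
    (hF : F ∈ supported ℤ {j | j < N}) :
    addCondition N p r i F ∈ supported ℤ {j | j < N + 15} := by
  have hX : ∀ j < N + 15, (X j : Poly) ∈ supported ℤ {j | j < N + 15} := fun j hj =>
    X_mem_supported.2 hj
  have hC : ∀ c : ℤ, (C c : Poly) ∈ supported ℤ {j | j < N + 15} := fun c =>
    Subalgebra.algebraMap_mem _ c
  have hF' := supported_mono (R := ℤ) (show {j | j < N} ⊆ {j | j < N + 15} from
    fun j hj => lt_of_lt_of_le hj (Nat.le_add_right _ _)) hF
  obtain ⟨F', rfl⟩ : ∃ F' : supported ℤ {j | j < N + 15}, (F' : Poly) = F := ⟨⟨F, hF'⟩, rfl⟩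
  let S := supported ℤ {j | j < N + 15}
  -- Only the first 15 values are ever read, so the default 0 is harmless.
  let v : ℕ → S := fun j => if h : j < 15 then ⟨X (N + j), hX _ (by omega)⟩ else 0
  have e : addCondition N p r i (F' : Poly) =
      ((conjunction (⟨C (p : ℤ), hC p⟩ : S) ⟨C (r : ℤ), hC r⟩ F' ⟨X i, hX i (by omega)⟩ v : S) :
        Poly) := by
    have := map_conjunction S.val.toRingHom (⟨C (p : ℤ), hC p⟩ : S) ⟨C (r : ℤ), hC r⟩ F'
      ⟨X i, hX i (by omega)⟩ v
    refine Eq.trans ?_ this.symm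
    refine conjunction_congr _ _ _ _ fun j hj => ?_
    simp [v, hj]
  rw [e]
  exact Subtype.property _

/-- The witnesses are integers, hence available in any `A`, and they are written into coordinates
from `N` on, which neither `F` nor `X i` nor `P` sees. The predicate `P` carries the conditions
still to be eliminated. -/
theorem hasRootWith_addCondition {A : Subring ℚ} {N p r i : ℕ} (hp : p.Prime)
    (hr : IsNonresidue p r) {F : Poly} (hi : i < N)
    (hF : F ∈ MvPolynomial.supported ℤ {j | j < N}) {P : (ℕ → ℚ) → Prop}
    (hP : ∀ x y : ℕ → ℚ, (∀ j < N, x j = y j) → P x → P y) :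
    HasRootWith A (addCondition N p r i F) P ↔
      HasRootWith A F (fun x => x i ∈ localRing p ∧ P x) := by
  constructor
  · rintro ⟨x, hx, h0, hPx⟩
    rw [aeval_addCondition] at h0
    obtain ⟨h1, h2⟩ := of_conjunction_eq_zero hp hr h0
    exact ⟨x, hx, h1, h2, hPx⟩
  · rintro ⟨x, hx, h0, hxi, hPx⟩
    obtain ⟨v, hv⟩ := exists_conjunction_eq_zero hp hr hxi
    let y : ℕ → ℚ := fun j => if j < N then x j else v (j - N)
    have hy : ∀ j < N, x j = y j := fun j hj => by simp [y, hj]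
    refine ⟨y, fun j => ?_, ?_, hP x y hy hPx⟩
    · by_cases hj : j < N
      · simp [y, hj, hx]
      · simp [y, hj, intCast_mem]
    · rw [aeval_addCondition, ← aeval_eq_of_agree hF hy, h0, ← hy i hi]
      simpa [y] using hv

/-- Adds several conditions, given as triples `(p, r, i)`. -/
noncomputable def addConditions (s : ℕ × Poly) (L : List (ℕ × ℕ × ℕ)) : ℕ × Poly :=
  L.foldl (fun s c => (s.1 + 15, addCondition s.1 c.1 c.2.1 c.2.2 s.2)) s

theorem hasRootWith_addConditions {A : Subring ℚ} (L : List (ℕ × ℕ × ℕ)) :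
    ∀ {N : ℕ} {F : Poly}, F ∈ MvPolynomial.supported ℤ {j | j < N} →
      (∀ c ∈ L, c.1.Prime ∧ IsNonresidue c.1 c.2.1 ∧ c.2.2 < N) →
      (HasRootWith A (addConditions (N, F) L).2 (fun _ => True) ↔
        HasRootWith A F (fun x => ∀ c ∈ L, x c.2.2 ∈ localRing c.1)) := by
  induction L with
  | nil => intro N F _ _; simp [addConditions, HasRootWith]
  | cons c L ih =>
    intro N F hF hL
    obtain ⟨hp, hr, hi⟩ := hL c List.mem_cons_self
    have h1 := ih (addCondition_mem_supported (p := c.1) (r := c.2.1) hi hF) (fun c' hc' => by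
      obtain ⟨a, b, d⟩ := hL c' (List.mem_cons_of_mem _ hc')
      exact ⟨a, b, by omega⟩)
    refine h1.trans ((hasRootWith_addCondition hp hr hi hF ?_).trans ?_)
    · intro x y hxy h c' hc'
      rw [← hxy _ (hL c' (List.mem_cons_of_mem _ hc')).2.2]
      exact h c' hc'
    · simp [HasRootWith]

theorem mem_HTP {f : ℕ → Poly} {A : Subring ℚ} {e : ℕ} :
    e ∈ HTP f A ↔ 0 < e ∧ HasRootWith A (f e) (fun _ => True) := by
  have key : ∀ x : ℕ → A, MvPolynomial.aeval (fun i => (x i : ℚ)) (f e) =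
      ((MvPolynomial.aeval x (f e) : A) : ℚ) := fun x =>
    (MvPolynomial.comp_aeval_apply (R := ℤ) x A.subtype.toIntAlgHom (f e)).symm
  refine and_congr_right fun _ => ⟨?_, ?_⟩
  · rintro ⟨x, hx⟩
    exact ⟨fun i => x i, fun i => (x i).2, by rw [key, hx]; rfl, trivial⟩
  · rintro ⟨x, hx, h0, -⟩
    refine ⟨fun i => ⟨x i, hx i⟩, ?_⟩
    rw [← Subtype.coe_inj]
    exact (key _).symm.trans h0

/-- The existence of a root in `ℤ[(M ∖ V)⁻¹]` is a condition on roots in `ℤ[M⁻¹]`. -/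
theorem hasRootWith_ringInv_diff {M V : Set ℕ} (hM : ∀ p ∈ M, p.Prime) (hV : ∀ p ∈ V, p.Prime)
    {N : ℕ} {F : Poly} (hF : F ∈ MvPolynomial.supported ℤ {j | j < N}) :
    HasRootWith (ringInv (M \ V)) F (fun _ => True) ↔
      HasRootWith (ringInv M) F (fun x => ∀ p ∈ V, ∀ i < N, x i ∈ localRing p) := by
  constructor
  · rintro ⟨x, hx, h0, -⟩
    exact ⟨x, fun i => ((mem_ringInv_diff hM hV).1 (hx i)).1, h0,
      fun p hp i _ => ((mem_ringInv_diff hM hV).1 (hx i)).2 p hp⟩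
  · rintro ⟨x, hx, h0, h⟩
    -- Coordinates that do not occur in `F` are reset to 0, as nothing is known about their
    -- denominators.
    refine ⟨fun i => if i < N then x i else 0, fun i => ?_, ?_, trivial⟩
    · rw [mem_ringInv_diff hM hV]
      by_cases hi : i < N
      · simp only [hi, if_true]
        exact ⟨hx i, fun p hp => h p hp i hi⟩
      · simp only [hi, if_false]
        exact ⟨zero_mem _, fun p _ => zero_mem _⟩
    · rw [← h0]
      exact aeval_eq_of_agree hF fun j hj => by simp [hj]

end PriorityHTP

namespace PriorityHTP

/-! ### The priority construction -/

open Classical in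
theorem firstOutside_mono {q : ℕ → ℕ} {S : Set ℕ} {m n : ℕ} (h : m ≤ n) :
    firstOutside q S m ⊆ firstOutside q S n := by
  rintro p ⟨i, h1, h2, h3⟩
  exact ⟨i, h1, h2, lt_of_lt_of_le h3 h⟩

-- Enlarging `S` only by elements beyond the first `n` leaves those `n` untouched and still first.
open Classical in
theorem firstOutside_eq_of_disjoint {q : ℕ → ℕ} {S S' : Set ℕ} {n : ℕ} (hS : S ⊆ S')
    (hd : ∀ p ∈ firstOutside q S n, p ∉ S') : firstOutside q S' n = firstOutside q S n := by
  refine Set.Subset.antisymm ?_ ?_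
  · rintro p ⟨i, rfl, h2, h3⟩
    refine ⟨i, rfl, fun h => h2 (hS h), ?_⟩
    by_contra! hcon
    -- At the least index where `n` terms outside `S` have been counted, all of them belong to the
    -- first `n`, so they lie outside `S'` too; already `n` terms outside `S'` precede `i`.
    have hex : ∃ i, n ≤ ((Finset.range i).filter fun k => q k ∉ S).card := ⟨i, hcon⟩
    have hle : Nat.find hex ≤ i := Nat.find_min' hex hcon
    have heq : (Finset.range (Nat.find hex)).filter (fun k => q k ∉ S) ⊆
        (Finset.range i).filter (fun k => q k ∉ S') := by
      intro k hk
      rw [Finset.mem_filter, Finset.mem_range] at hk ⊢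
      refine ⟨lt_of_lt_of_le hk.1 hle, hd _ ⟨k, rfl, hk.2, ?_⟩⟩
      exact not_le.1 (Nat.find_min hex hk.1)
    have := Finset.card_le_card heq
    have := Nat.find_spec hex
    omega
  · intro p hp
    have hp' := hd p hp
    obtain ⟨i, rfl, h2, h3⟩ := hp
    refine ⟨i, rfl, hp', lt_of_le_of_lt (Finset.card_le_card ?_) h3⟩
    intro k hk
    rw [Finset.mem_filter] at hk ⊢
    exact ⟨hk.1, fun h => hk.2 (hS h)⟩

section index

variable {f : ℕ → Poly} (hf : Set.BijOn f (Set.Ici 1) Set.univ)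

include hf

theorem polyIndex_spec (p : Poly) : 0 < polyIndex f p ∧ f (polyIndex f p) = p := by
  have : ({e | 0 < e ∧ f e = p} : Set ℕ).Nonempty := by
    obtain ⟨e, he, h⟩ := hf.surjOn (Set.mem_univ p)
    exact ⟨e, he, h⟩
  exact Nat.sInf_mem this

theorem polyIndex_apply {e : ℕ} (he : 0 < e) : polyIndex f (f e) = e :=
  hf.injOn (polyIndex_spec hf (f e)).1 he (polyIndex_spec hf (f e)).2

end index

section stages

variable {q : ℕ → ℕ} {M : Set ℕ} {f : ℕ → Poly} {g : ℕ → Poly × List ℚ × ℕ} {h : ℕ → ℕ}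

/-- The condition under which a stage changes the state. -/
def Acts (q : ℕ → ℕ) (M : Set ℕ) (f : ℕ → Poly) (g : ℕ → Poly × List ℚ × ℕ) (h : ℕ → ℕ)
    (s : ℕ) : Prop :=
  polyIndex f (g (s + 1)).1 ∉ (stage q M f g h s).isTrue ∧
    (∀ a ∈ (g (s + 1)).2.1,
      a ∈ ringInv (M \ firstOutside q (stage q M f g h s).inverted (h (s + 1)))) ∧
    evalTuple (f (polyIndex f (g (s + 1)).1)) (g (s + 1)).2.1 = 0

theorem stage_succ_of_acts {s : ℕ} (hs : Acts q M f g h s) :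
    stage q M f g h (s + 1) = ⟨(stage q M f g h s).inverted ∪ denPrimes (g (s + 1)).2.1,
      insert (polyIndex f (g (s + 1)).1) (stage q M f g h s).isTrue⟩ := by
  rw [stage]
  exact if_pos hs

theorem stage_succ_of_not_acts {s : ℕ} (hs : ¬ Acts q M f g h s) :
    stage q M f g h (s + 1) = stage q M f g h s := by
  rw [stage]
  exact if_neg hs

theorem inverted_mono : Monotone fun s => (stage q M f g h s).inverted := by
  refine monotone_nat_of_le_succ fun s => ?_
  by_cases hs : Acts q M f g h s
  · rw [stage_succ_of_acts hs]; exact Set.subset_union_left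
  · rw [stage_succ_of_not_acts hs]

theorem isTrue_mono : Monotone fun s => (stage q M f g h s).isTrue := by
  refine monotone_nat_of_le_succ fun s => ?_
  by_cases hs : Acts q M f g h s
  · rw [stage_succ_of_acts hs]; exact Set.subset_insert _ _
  · rw [stage_succ_of_not_acts hs]

theorem Acts.denPrimes_subset (hM : ∀ p ∈ M, p.Prime) {s : ℕ} (hs : Acts q M f g h s) :
    denPrimes (g (s + 1)).2.1 ⊆
      M \ firstOutside q (stage q M f g h s).inverted (h (s + 1)) := by
  rintro p ⟨hp, a, ha, hd⟩
  exact (mem_ringInv fun p hp => hM p hp.1).1 (hs.2.1 a ha) p hp hd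

theorem inverted_subset (hM : ∀ p ∈ M, p.Prime) (s : ℕ) : (stage q M f g h s).inverted ⊆ M := by
  induction s with
  | zero => simp [stage]
  | succ s ih =>
    by_cases hs : Acts q M f g h s
    · rw [stage_succ_of_acts hs]
      exact Set.union_subset ih ((hs.denPrimes_subset hM).trans Set.sdiff_subset)
    · rwa [stage_succ_of_not_acts hs]

theorem invertedSet_subset (hM : ∀ p ∈ M, p.Prime) : invertedSet q M f g h ⊆ M :=
  Set.iUnion_subset fun s => inverted_subset hM s

theorem exists_tuple_of_mem_isTrue {s e : ℕ} (he : 0 < e)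
    (hs : e ∈ (stage q M f g h s).isTrue) :
    ∃ x, denPrimes x ⊆ (stage q M f g h s).inverted ∧ evalTuple (f e) x = 0 := by
  induction s with
  | zero => simp only [stage, Set.mem_singleton_iff] at hs; omega
  | succ s ih =>
    by_cases ha : Acts q M f g h s
    · rw [stage_succ_of_acts ha] at hs ⊢
      rcases hs with rfl | hs
      · exact ⟨_, Set.subset_union_right, ha.2.2⟩
      · obtain ⟨x, h1, h2⟩ := ih hs
        exact ⟨x, h1.trans Set.subset_union_left, h2⟩
    · rw [stage_succ_of_not_acts ha] at hs ⊢
      exact ih hs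

theorem mem_HTP_of_mem_isTrue (hM : ∀ p ∈ M, p.Prime) {s e : ℕ} (he : 0 < e)
    (hs : e ∈ (stage q M f g h s).isTrue) : e ∈ HTP f (ringInv (invertedSet q M f g h)) := by
  obtain ⟨x, h1, h2⟩ := exists_tuple_of_mem_isTrue he hs
  refine mem_HTP.2 ⟨he, fun i => x.getD i 0, fun i => ?_, h2, trivial⟩
  show x.getD i 0 ∈ _
  by_cases hi : i < x.length
  · rw [List.getD_eq_getElem _ _ hi]
    refine (mem_ringInv fun p hp => hM p (invertedSet_subset hM hp)).2 fun p hp hd => ?_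
    exact Set.mem_iUnion.2 ⟨s, h1 ⟨hp, _, List.getElem_mem hi, hd⟩⟩
  · rw [List.getD_eq_default _ _ (not_lt.1 hi)]
    exact zero_mem _

/-- The third component `j` is free, so every pair is listed at infinitely many stages. -/
theorem exists_stage_ge (hg : Set.BijOn g (Set.Ici 1) (triples M)) {F : Poly} {x : List ℚ}
    (h1 : ∀ i ∈ F.vars, i < x.length) (h2 : ∀ a ∈ x, a ∈ ringInv M) (B : ℕ) :
    ∃ s > B, ∃ j, g s = (F, x, j) := by
  have key : ∀ j : ℕ, ∃ s, g s = (F, x, j + 1) := fun j => by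
    obtain ⟨s, -, hs⟩ := hg.surjOn (show (F, x, j + 1) ∈ triples M from ⟨h1, h2, j.succ_pos⟩)
    exact ⟨s, hs⟩
  choose t ht using key
  have hinj : Function.Injective t := fun i j hij => by
    have := (ht i).symm.trans ((congrArg g hij).trans (ht j))
    simpa using this
  obtain ⟨_, ⟨j, rfl⟩, hj⟩ := (Set.infinite_range_of_injective hinj).exists_gt B
  exact ⟨t j, hj, j + 1, ht j⟩

theorem exists_isTrue_bound (e : ℕ) : ∃ B, ∀ i, 1 ≤ i → i ≤ e →
    (∃ t, i ∈ (stage q M f g h t).isTrue) → ∀ s ≥ B, i ∈ (stage q M f g h s).isTrue := by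
  induction e with
  | zero => exact ⟨0, fun i h1 h2 => by omega⟩
  | succ e ih =>
    obtain ⟨B, hB⟩ := ih
    by_cases ht : ∃ t, e + 1 ∈ (stage q M f g h t).isTrue
    · obtain ⟨t, ht⟩ := ht
      refine ⟨max B t, fun i h1 h2 h3 s hs => ?_⟩
      rcases Nat.lt_or_ge e i with h4 | h4
      · obtain rfl : i = e + 1 := by omega
        exact isTrue_mono (le_trans (le_max_right _ _) hs) ht
      · exact hB i h1 h4 h3 s (le_trans (le_max_left _ _) hs)
    · refine ⟨B, fun i h1 h2 h3 s hs => ?_⟩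
      rcases Nat.lt_or_ge e i with h4 | h4
      · obtain rfl : i = e + 1 := by omega
        exact absurd h3 ht
      · exact hB i h1 h4 h3 s hs

/-- Needed because the infimum in `keyStage` is informative only for a nonempty set. Finitely many
variables settle by some stage, and `f (e + 1)` is still listed afterwards. -/
theorem keyStage_set_nonempty (hg : Set.BijOn g (Set.Ici 1) (triples M)) (e : ℕ) :
    ({s | keyStage q M f g h e < s ∧
      (∀ i, 1 ≤ i → i ≤ e → (∃ t, i ∈ (stage q M f g h t).isTrue) →
        i ∈ (stage q M f g h s).isTrue) ∧
      ∃ x j, g s = (f (e + 1), x, j)} : Set ℕ).Nonempty := by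
  obtain ⟨B, hB⟩ := exists_isTrue_bound (q := q) (M := M) (f := f) (g := g) (h := h) e
  obtain ⟨N, hN⟩ := (f (e + 1)).vars.bddAbove
  obtain ⟨s, hs, j, hj⟩ := exists_stage_ge hg (F := f (e + 1)) (x := List.replicate (N + 1) 0)
    (fun i hi => by simpa using Nat.lt_succ_of_le (hN hi))
    (fun a ha => by rw [List.eq_of_mem_replicate ha]; exact zero_mem _)
    (max (keyStage q M f g h e) B)
  exact ⟨s, lt_of_le_of_lt (le_max_left _ _) hs,
    fun i h1 h2 h3 => hB i h1 h2 h3 s (le_trans (le_max_right _ _) hs.le), _, j, hj⟩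

theorem keyStage_spec (hg : Set.BijOn g (Set.Ici 1) (triples M)) (e : ℕ) :
    keyStage q M f g h e < keyStage q M f g h (e + 1) ∧
      (∀ i, 1 ≤ i → i ≤ e → (∃ t, i ∈ (stage q M f g h t).isTrue) →
        i ∈ (stage q M f g h (keyStage q M f g h (e + 1))).isTrue) ∧
      ∃ x j, g (keyStage q M f g h (e + 1)) = (f (e + 1), x, j) :=
  Nat.sInf_mem (keyStage_set_nonempty hg e)

/-- The set of primes protected from the stage `s_e` on. -/
def protectedPrimes (q : ℕ → ℕ) (M : Set ℕ) (f : ℕ → Poly) (g : ℕ → Poly × List ℚ × ℕ)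
    (h : ℕ → ℕ) (s : ℕ) : Set ℕ :=
  firstOutside q (stage q M f g h (s - 1)).inverted (h s)

section

variable (hM : ∀ p ∈ M, p.Prime) (hf : Set.BijOn f (Set.Ici 1) Set.univ)
  (hg : Set.BijOn g (Set.Ici 1) (triples M)) (hadm : Admissible q M f g h)

include hM hf hg hadm

/-- Induction on the stage. An action of index below `e + 1` is impossible, since that variable is
already TRUE; one of index at least `e + 1` respects a protected set containing this one, by the
conditions on `h`. Hence the primes it inverts are not among the protected ones. -/
theorem firstOutside_eq_protectedPrimes (e : ℕ) {s : ℕ}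
    (hs : keyStage q M f g h (e + 1) ≤ s + 1) :
    firstOutside q (stage q M f g h s).inverted (h (keyStage q M f g h (e + 1))) =
      protectedPrimes q M f g h (keyStage q M f g h (e + 1)) := by
  obtain ⟨k1, k2, x₀, j₀, k3⟩ := keyStage_spec (q := q) (f := f) (h := h) hg e
  obtain ⟨s₀, hs₀⟩ : ∃ s₀, keyStage q M f g h (e + 1) = s₀ + 1 :=
    ⟨keyStage q M f g h (e + 1) - 1, by omega⟩
  have hs' : s₀ ≤ s := by omega
  induction s, hs' using Nat.le_induction with
  | base => simp [protectedPrimes, hs₀]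
  | succ s hle ih =>
    rw [← ih (by omega)]
    by_cases ha : Acts q M f g h s
    swap
    · rw [stage_succ_of_not_acts ha]
    refine firstOutside_eq_of_disjoint (inverted_mono (Nat.le_succ s)) fun p hp => ?_
    rw [stage_succ_of_acts ha]
    rintro (hp' | hp')
    · obtain ⟨i, rfl, h2, -⟩ := hp
      exact h2 hp'
    · refine (ha.denPrimes_subset hM hp').2 (firstOutside_mono ?_ hp)
      obtain ⟨hi1, hi2⟩ := polyIndex_spec hf (g (s + 1)).1
      have hgs : g (s + 1) = (f (polyIndex f (g (s + 1)).1), (g (s + 1)).2.1, (g (s + 1)).2.2) := by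
        rw [hi2]
      have htrue : polyIndex f (g (s + 1)).1 ∈ (stage q M f g h (s + 1)).isTrue := by
        rw [stage_succ_of_acts ha]; exact Set.mem_insert _ _
      -- The key stage itself needs care: a variable TRUE at its end could have been set there, and
      -- the condition on larger indices applies only to strictly later stages. But the index
      -- treated at that stage is `e + 1`.
      have hcase : s = s₀ → polyIndex f (g (s + 1)).1 = e + 1 := by
        rintro rfl
        rw [← hs₀, k3]
        exact polyIndex_apply hf e.succ_pos
      rcases lt_trichotomy (polyIndex f (g (s + 1)).1) (e + 1) with hlt | heq | hgt
      · exfalso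
        have hmem := k2 _ hi1 (by omega) ⟨_, htrue⟩
        have : s ≠ s₀ := fun e => by have := hcase e; omega
        exact ha.1 (isTrue_mono (show keyStage q M f g h (e + 1) ≤ s by omega) hmem)
      · exact (hadm.eq_of_le (e + 1) (by omega) (s + 1) (by omega)
          ⟨_, _, hgs.trans (by rw [heq])⟩).ge
      · have : s ≠ s₀ := fun e => by have := hcase e; omega
        exact hadm.le_of_lt (e + 1) (by omega) _ hgt (s + 1) (by omega) ⟨_, _, hgs⟩

theorem disjoint_protectedPrimes (e : ℕ) : Disjoint (invertedSet q M f g h)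
    (protectedPrimes q M f g h (keyStage q M f g h (e + 1))) := by
  rw [Set.disjoint_left]
  intro p hp hp'
  obtain ⟨s, hs⟩ := Set.mem_iUnion.1 hp
  rw [← firstOutside_eq_protectedPrimes hM hf hg hadm e
    (s := max s (keyStage q M f g h (e + 1))) (by omega)] at hp'
  obtain ⟨i, rfl, h2, -⟩ := hp'
  exact h2 (inverted_mono (le_max_left _ _) hs)

/-- The root is listed at a stage after the key stage, where the protected set is still the same; so
either the variable is already TRUE or this stage acts. -/
theorem exists_mem_isTrue_of_hasRootWith (e : ℕ)
    (hr : HasRootWith (ringInv (M \ protectedPrimes q M f g h (keyStage q M f g h (e + 1))))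
      (f (e + 1)) (fun _ => True)) :
    ∃ t, e + 1 ∈ (stage q M f g h t).isTrue := by
  obtain ⟨x, hx, h0, -⟩ := hr
  obtain ⟨N, hN⟩ := (f (e + 1)).vars.bddAbove
  have hmem : ∀ a ∈ (List.range (N + 1)).map x,
      a ∈ ringInv (M \ protectedPrimes q M f g h (keyStage q M f g h (e + 1))) := by
    intro a ha
    obtain ⟨i, -, rfl⟩ := List.mem_map.1 ha
    exact hx i
  obtain ⟨s, hs, j, hj⟩ := exists_stage_ge hg (F := f (e + 1)) (x := (List.range (N + 1)).map x)
    (fun i hi => by simpa using Nat.lt_succ_of_le (hN hi))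
    (fun a ha => Subring.closure_mono (Set.image_mono Set.sdiff_subset) (hmem a ha))
    (keyStage q M f g h (e + 1))
  obtain ⟨t, rfl⟩ : ∃ t, s = t + 1 := ⟨s - 1, by omega⟩
  have hidx : polyIndex f (g (t + 1)).1 = e + 1 := by
    rw [hj]; exact polyIndex_apply hf e.succ_pos
  by_cases ht : e + 1 ∈ (stage q M f g h t).isTrue
  · exact ⟨t, ht⟩
  · have ha : Acts q M f g h t := by
      refine ⟨by rwa [hidx], ?_, ?_⟩
      · rw [hadm.eq_of_le (e + 1) (by omega) (t + 1) hs.le ⟨_, _, hj⟩,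
          firstOutside_eq_protectedPrimes hM hf hg hadm e hs.le, hj]
        exact hmem
      · rw [hidx, hj, ← h0]
        refine aeval_eq_of_agree (N := N + 1) ?_ fun i hi => ?_
        · rw [MvPolynomial.mem_supported]
          exact fun i hi => Nat.lt_succ_of_le (hN hi)
        · rw [List.getD_eq_getElem _ _ (by simpa using hi)]
          simp
    refine ⟨t + 1, ?_⟩
    rw [stage_succ_of_acts ha, hidx]
    exact Set.mem_insert _ _

theorem hasRootWith_of_mem_HTP (e : ℕ) (he : e + 1 ∈ HTP f (ringInv (invertedSet q M f g h))) :
    HasRootWith (ringInv (M \ protectedPrimes q M f g h (keyStage q M f g h (e + 1))))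
      (f (e + 1)) (fun _ => True) := by
  obtain ⟨-, x, hx, h0, -⟩ := mem_HTP.1 he
  refine ⟨x, fun i => Subring.closure_mono (Set.image_mono (Set.subset_sdiff.2 ⟨?_, ?_⟩)) (hx i), h0, trivial⟩
  · exact invertedSet_subset hM
  · exact disjoint_protectedPrimes hM hf hg hadm e

theorem mem_HTP_iff_hasRootWith (e : ℕ) :
    e + 1 ∈ HTP f (ringInv (invertedSet q M f g h)) ↔
      HasRootWith (ringInv (M \ protectedPrimes q M f g h (keyStage q M f g h (e + 1))))
        (f (e + 1)) (fun _ => True) := by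
  refine ⟨hasRootWith_of_mem_HTP hM hf hg hadm e, fun hr => ?_⟩
  obtain ⟨t, ht⟩ := exists_mem_isTrue_of_hasRootWith hM hf hg hadm e hr
  exact mem_HTP_of_mem_isTrue hM e.succ_pos ht

/-- This lets the recursion replace "ever set to TRUE", which is not decidable from the stages, by
answers already computed. -/
theorem mem_HTP_iff_exists_isTrue {e : ℕ} (he : 0 < e) :
    e ∈ HTP f (ringInv (invertedSet q M f g h)) ↔ ∃ t, e ∈ (stage q M f g h t).isTrue := by
  refine ⟨fun hr => ?_, fun ⟨t, ht⟩ => mem_HTP_of_mem_isTrue hM he ht⟩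
  obtain ⟨e, rfl⟩ : ∃ e', e = e' + 1 := ⟨e - 1, by omega⟩
  exact exists_mem_isTrue_of_hasRootWith hM hf hg hadm e
    (hasRootWith_of_mem_HTP hM hf hg hadm e hr)

end

end stages

end PriorityHTP

namespace PriorityHTP

open Primrec

/-! ### Primitive recursive arithmetic -/

section quantifiers

variable {α β : Type*} [Primcodable α] [Primcodable β]

theorem primrecPred_forall_mem {f : α → List β} {R : α → β → Prop} (hf : Primrec f)
    (hR : PrimrecRel R) : PrimrecPred fun a => ∀ b ∈ f a, R a b :=
  hR.swap.forall_mem_list.comp hf Primrec.id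

theorem primrecPred_forall_lt {f : α → ℕ} {R : α → ℕ → Prop} (hf : Primrec f)
    (hR : PrimrecRel R) : PrimrecPred fun a => ∀ b < f a, R a b :=
  (primrecPred_forall_mem (list_range.comp hf) hR).of_eq fun a => by simp

theorem primrec_filter {f : α → List β} {R : α → β → Prop} [DecidableRel R] (hf : Primrec f)
    (hR : PrimrecRel R) : Primrec fun a => (f a).filter (fun b => R a b) := by
  have : DecidableRel (Function.swap R) := fun b a => inferInstanceAs (Decidable (R a b))
  exact (hR.swap.listFilter.comp hf Primrec.id).of_eq fun a =>
    List.filter_congr fun b _ => by simp [Function.swap]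

theorem primrec_list_sum {β : Type*} [Primcodable β] [AddMonoid β]
    (h : Primrec₂ fun a b : β => a + b) : Primrec (List.sum : List β → β) :=
  (list_foldr Primrec.id (const 0) (h.comp (fst.comp snd) (snd.comp snd)).to₂).of_eq fun l => by
    induction l with
    | nil => rfl
    | cons a l ih => rw [List.sum_cons, ← ih]; rfl

theorem primrec_list_prod {β : Type*} [Primcodable β] [Monoid β]
    (h : Primrec₂ fun a b : β => a * b) : Primrec (List.prod : List β → β) :=
  (list_foldr Primrec.id (const 1) (h.comp (fst.comp snd) (snd.comp snd)).to₂).of_eq fun l => by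
    induction l with
    | nil => rfl
    | cons a l ih => rw [List.prod_cons, ← ih]; rfl

end quantifiers

section nat

theorem primrec_dvd : PrimrecRel fun a b : ℕ => a ∣ b :=
  PrimrecPred.of_eq (p := fun x : ℕ × ℕ => x.2 % x.1 = 0)
    (Primrec.eq.comp (nat_mod.comp snd fst) (const 0))
    fun _ => (Nat.dvd_iff_mod_eq_zero).symm

theorem primrec_prime : PrimrecPred Nat.Prime :=
  ((nat_le.comp (const 2) Primrec.id).and (primrecPred_forall_lt Primrec.id
    (R := fun p m => m ∣ p → m = 1) ((primrec_dvd.comp snd fst).not.or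
      (Primrec.eq.comp snd (const 1)) |>.of_eq fun _ => imp_iff_not_or.symm))).of_eq
  fun p => by rw [Nat.prime_def_lt]; rfl

theorem primrec_gcd : Primrec₂ Nat.gcd := by
  have h : Primrec fun x : ℕ × ℕ => Nat.findGreatest (fun d => d ∣ x.1 ∧ d ∣ x.2) (x.1 + x.2) :=
    nat_findGreatest (nat_add.comp fst snd)
      ((primrec_dvd.comp snd (fst.comp fst)).and (primrec_dvd.comp snd (snd.comp fst)))
  refine h.of_eq fun x => ?_
  obtain ⟨a, b⟩ := x
  rcases Nat.eq_zero_or_pos (a + b) with h0 | h0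
  · obtain ⟨rfl, rfl⟩ : a = 0 ∧ b = 0 := by omega
    rfl
  refine le_antisymm ?_ ?_
  · have hs : (fun d => d ∣ a ∧ d ∣ b) (Nat.findGreatest (fun d => d ∣ a ∧ d ∣ b) (a + b)) :=
      Nat.findGreatest_spec (P := fun d => d ∣ a ∧ d ∣ b) (m := 1) h0 ⟨one_dvd _, one_dvd _⟩
    exact Nat.le_of_dvd (Nat.gcd_pos_iff.2 (by omega)) (Nat.dvd_gcd hs.1 hs.2)
  · refine Nat.le_findGreatest (P := fun d => d ∣ a ∧ d ∣ b) ?_ ⟨Nat.gcd_dvd_left a b, Nat.gcd_dvd_right a b⟩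
    have hd : Nat.gcd a b ∣ a + b := dvd_add (Nat.gcd_dvd_left a b) (Nat.gcd_dvd_right a b)
    exact Nat.le_of_dvd h0 hd

theorem primrec_isNonresidue : PrimrecRel IsNonresidue := by
  have h1 : PrimrecPred fun x : ℕ × ℕ => Odd x.2 :=
    (Primrec.eq.comp (nat_mod.comp snd (const 2)) (const 1)).of_eq fun x => Nat.odd_iff.symm
  have h2 : PrimrecPred fun x : ℕ × ℕ => x.1 = 2 := Primrec.eq.comp fst (const 2)
  have h3 : PrimrecPred fun x : ℕ × ℕ => x.2 % 8 = 5 :=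
    Primrec.eq.comp (nat_mod.comp snd (const 8)) (const 5)
  have h4 : PrimrecPred fun x : ℕ × ℕ => ∀ y < x.1, y ^ 2 % x.1 ≠ x.2 % x.1 := by
    refine primrecPred_forall_lt (R := fun (x : ℕ × ℕ) y => y ^ 2 % x.1 ≠ x.2 % x.1) fst ?_
    refine ((Primrec.eq.comp (nat_mod.comp (nat_mul.comp snd snd) (fst.comp fst))
      (nat_mod.comp (snd.comp fst) (fst.comp fst))).not).of_eq fun x => ?_
    simp [sq]
  exact (h1.and ((h2.and h3).or (h2.not.and h4))).of_eq fun x => by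
    by_cases h : x.1 = 2 <;> simp [IsNonresidue, h]

open Classical in
/-- A number satisfying `IsNonresidue p`, for `p` prime. -/
noncomputable def nonresidue (p : ℕ) : ℕ := Nat.findGreatest (IsNonresidue p) (2 * p + 5)

theorem primrec_nonresidue : Primrec nonresidue := by
  classical
  exact nat_findGreatest (nat_add.comp (nat_mul.comp (const 2) Primrec.id) (const 5))
    primrec_isNonresidue

open Classical in
theorem isNonresidue_nonresidue {p : ℕ} (hp : p.Prime) : IsNonresidue p (nonresidue p) := by
  obtain ⟨r, hr, h⟩ := exists_isNonresidue hp
  exact Nat.findGreatest_spec hr h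

end nat

section int

theorem intEquivNat_ofNat (n : ℕ) : Equiv.intEquivNat (n : ℤ) = 2 * n := rfl

theorem intEquivNat_negSucc (n : ℕ) : Equiv.intEquivNat (Int.negSucc n) = 2 * n + 1 := rfl

theorem primrec_intEquivNat : Primrec Equiv.intEquivNat :=
  (Primrec.encode (α := ℤ)).of_eq fun _ => rfl

theorem primrec_intEquivNat_symm : Primrec Equiv.intEquivNat.symm :=
  (Primrec.ofNat ℤ).of_eq fun _ => rfl

theorem primrec_toNat : Primrec Int.toNat := by
  have h : Primrec fun z : ℤ => if Equiv.intEquivNat z % 2 = 0 then Equiv.intEquivNat z / 2 else 0 :=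
    Primrec.ite (Primrec.eq.comp (nat_mod.comp primrec_intEquivNat (const 2)) (const 0))
      (nat_div.comp primrec_intEquivNat (const 2)) (const 0)
  refine h.of_eq fun z => ?_
  rcases z with n | n
  · rw [Int.ofNat_eq_natCast, intEquivNat_ofNat]; simp
  · rw [intEquivNat_negSucc, if_neg (by omega)]; rfl

theorem primrec_neg_toNat : Primrec fun z : ℤ => (-z).toNat := by
  have h : Primrec fun z : ℤ =>
      if Equiv.intEquivNat z % 2 = 0 then 0 else Equiv.intEquivNat z / 2 + 1 :=
    Primrec.ite (Primrec.eq.comp (nat_mod.comp primrec_intEquivNat (const 2)) (const 0))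
      (const 0) (nat_add.comp (nat_div.comp primrec_intEquivNat (const 2)) (const 1))
  refine h.of_eq fun z => ?_
  rcases z with n | n
  · rw [Int.ofNat_eq_natCast, intEquivNat_ofNat]; simp
  · rw [intEquivNat_negSucc, if_neg (by omega), Int.neg_negSucc]
    simp only [Int.toNat_natCast]
    omega

/-- In the coding of `ℤ`, `n` becomes `2n` and `-(n+1)` becomes `2n+1`. With the decomposition into
positive and negative parts, this difference reduces integer arithmetic to that of `ℕ`. -/
theorem primrec_natCast_sub : Primrec₂ fun a b : ℕ => (a : ℤ) - b := by
  have h : Primrec fun x : ℕ × ℕ => Equiv.intEquivNat.symm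
      (if x.2 ≤ x.1 then 2 * (x.1 - x.2) else 2 * (x.2 - x.1 - 1) + 1) :=
    primrec_intEquivNat_symm.comp (Primrec.ite (nat_le.comp snd fst)
      (nat_mul.comp (const 2) (nat_sub.comp fst snd))
      (nat_add.comp (nat_mul.comp (const 2) (nat_sub.comp (nat_sub.comp snd fst) (const 1)))
        (const 1)))
  refine h.of_eq fun x => ?_
  show _ = (x.1 : ℤ) - x.2
  rw [Equiv.symm_apply_eq]
  split_ifs with hx
  · have : (x.1 : ℤ) - x.2 = ((x.1 - x.2 : ℕ) : ℤ) := by omega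
    rw [this, intEquivNat_ofNat]
  · have : (x.1 : ℤ) - x.2 = Int.negSucc (x.2 - x.1 - 1) := by omega
    rw [this, intEquivNat_negSucc]

theorem primrec_natCast : Primrec fun n : ℕ => (n : ℤ) :=
  (primrec_natCast_sub.comp Primrec.id (const 0)).of_eq fun n => by simp

theorem primrec_int_add : Primrec₂ fun a b : ℤ => a + b := by
  have h : Primrec fun x : ℤ × ℤ =>
      (((x.1.toNat + x.2.toNat : ℕ) : ℤ) - (((-x.1).toNat + (-x.2).toNat : ℕ) : ℤ)) :=
    primrec_natCast_sub.comp
      (nat_add.comp (primrec_toNat.comp fst) (primrec_toNat.comp snd))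
      (nat_add.comp (primrec_neg_toNat.comp fst) (primrec_neg_toNat.comp snd))
  exact h.of_eq fun x => show _ = x.1 + x.2 by omega

theorem primrec_int_mul : Primrec₂ fun a b : ℤ => a * b := by
  have h : Primrec fun x : ℤ × ℤ =>
      (((x.1.toNat * x.2.toNat + (-x.1).toNat * (-x.2).toNat : ℕ) : ℤ) -
        ((x.1.toNat * (-x.2).toNat + (-x.1).toNat * x.2.toNat : ℕ) : ℤ)) :=
    primrec_natCast_sub.comp
      (nat_add.comp (nat_mul.comp (primrec_toNat.comp fst) (primrec_toNat.comp snd))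
        (nat_mul.comp (primrec_neg_toNat.comp fst) (primrec_neg_toNat.comp snd)))
      (nat_add.comp (nat_mul.comp (primrec_toNat.comp fst) (primrec_neg_toNat.comp snd))
        (nat_mul.comp (primrec_neg_toNat.comp fst) (primrec_toNat.comp snd)))
  refine h.of_eq fun x => ?_
  have e1 : ((x.1.toNat : ℤ)) - (-x.1).toNat = x.1 := by omega
  have e2 : ((x.2.toNat : ℤ)) - (-x.2).toNat = x.2 := by omega
  calc _ = ((x.1.toNat : ℤ) - (-x.1).toNat) * ((x.2.toNat : ℤ) - (-x.2).toNat) := by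
        push_cast; ring
    _ = _ := by rw [e1, e2]

theorem primrec_natAbs : Primrec Int.natAbs :=
  (nat_add.comp primrec_toNat primrec_neg_toNat).of_eq fun a => by omega

end int

/-! ### Arithmetic on codes of rationals and evaluation of polynomials -/

section rat

theorem primrec_den : Primrec fun c : ℤ × ℕ => (ratOfCode c).den := by
  have h : Primrec fun c : ℤ × ℕ => (c.2 + 1) / Nat.gcd c.1.natAbs (c.2 + 1) :=
    nat_div.comp (succ.comp snd) (primrec_gcd.comp (primrec_natAbs.comp fst) (succ.comp snd))
  refine h.of_eq fun c => ?_
  have e : ratOfCode c = mkRat c.1 (c.2 + 1) := by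
    rw [Rat.mkRat_eq_div, ratOfCode]; push_cast; rfl
  rw [e, Rat.den_mkRat, if_neg (Nat.succ_ne_zero _), Nat.gcd_comm]

/-- Addition of codes of rational numbers. -/
def ratAdd (a b : ℤ × ℕ) : ℤ × ℕ :=
  (a.1 * ((b.2 + 1 : ℕ) : ℤ) + b.1 * ((a.2 + 1 : ℕ) : ℤ), (a.2 + 1) * (b.2 + 1) - 1)

/-- Multiplication of codes of rational numbers. -/
def ratMul (a b : ℤ × ℕ) : ℤ × ℕ := (a.1 * b.1, (a.2 + 1) * (b.2 + 1) - 1)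

/-- Codes store the denominator minus one, so a product of denominators involves a truncated
subtraction. -/
theorem cast_pred_mul (a b : ℕ) :
    (((a + 1) * (b + 1) - 1 : ℕ) : ℚ) + 1 = ((a : ℚ) + 1) * (b + 1) := by
  have : 1 ≤ (a + 1) * (b + 1) := Nat.mul_pos a.succ_pos b.succ_pos
  push_cast [Nat.cast_sub this]
  ring

theorem ratOfCode_ratAdd (a b : ℤ × ℕ) :
    ratOfCode (ratAdd a b) = ratOfCode a + ratOfCode b := by
  have h1 : (a.2 : ℚ) + 1 ≠ 0 := by positivity
  have h2 : (b.2 : ℚ) + 1 ≠ 0 := by positivity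
  simp only [ratOfCode, ratAdd, cast_pred_mul]
  push_cast
  field_simp

theorem ratOfCode_ratMul (a b : ℤ × ℕ) :
    ratOfCode (ratMul a b) = ratOfCode a * ratOfCode b := by
  have h1 : (a.2 : ℚ) + 1 ≠ 0 := by positivity
  have h2 : (b.2 : ℚ) + 1 ≠ 0 := by positivity
  simp only [ratOfCode, ratMul, cast_pred_mul]
  push_cast
  field_simp

theorem primrec_ratAdd : Primrec₂ ratAdd :=
  Primrec.pair (primrec_int_add.comp
      (primrec_int_mul.comp (fst.comp fst) (primrec_natCast.comp (succ.comp (snd.comp snd))))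
      (primrec_int_mul.comp (fst.comp snd) (primrec_natCast.comp (succ.comp (snd.comp fst)))))
    (nat_sub.comp (nat_mul.comp (succ.comp (snd.comp fst)) (succ.comp (snd.comp snd))) (const 1))

theorem primrec_ratMul : Primrec₂ ratMul :=
  Primrec.pair (primrec_int_mul.comp (fst.comp fst) (fst.comp snd))
    (nat_sub.comp (nat_mul.comp (succ.comp (snd.comp fst)) (succ.comp (snd.comp snd))) (const 1))

/-- Exponentiation of codes of rational numbers. -/
def ratPow (a : ℤ × ℕ) (n : ℕ) : ℤ × ℕ := n.rec (1, 0) fun _ b => ratMul b a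

theorem ratOfCode_ratPow (a : ℤ × ℕ) (n : ℕ) : ratOfCode (ratPow a n) = ratOfCode a ^ n := by
  induction n with
  | zero => simp [ratPow, ratOfCode]
  | succ n ih => rw [pow_succ, ← ih, ← ratOfCode_ratMul]; rfl

theorem primrec_ratPow : Primrec₂ ratPow :=
  (nat_rec (const (1, 0)) (primrec_ratMul.comp (snd.comp snd) fst).to₂).of_eq fun _ _ => rfl

/-- The value of a term at a tuple, in terms of codes. -/
def monomialValue (x : List (ℤ × ℕ)) (t : List ℕ × ℤ) : ℤ × ℕ :=
  ratMul (t.2, 0) (((List.range t.1.length).map fun i =>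
    ratPow (x.getD i (0, 0)) (t.1.getD i 0)).foldr ratMul (1, 0))

/-- The value of a polynomial at a tuple, in terms of codes. -/
def evalCode (x : List (ℤ × ℕ)) (l : List (List ℕ × ℤ)) : ℤ × ℕ :=
  (l.map (monomialValue x)).foldr ratAdd (0, 0)

theorem primrec_monomialValue : Primrec₂ monomialValue := by
  have h1 : Primrec₂ fun (a : List (ℤ × ℕ) × List ℕ × ℤ) (i : ℕ) =>
      ratPow (a.1.getD i (0, 0)) (a.2.1.getD i 0) :=
    primrec_ratPow.comp ((list_getD (0, 0)).comp (fst.comp fst) snd)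
      ((list_getD 0).comp (fst.comp (snd.comp fst)) snd)
  exact primrec_ratMul.comp (Primrec.pair (snd.comp snd) (const 0))
    (list_foldr (list_map (list_range.comp (list_length.comp (fst.comp snd))) h1) (const (1, 0))
      (primrec_ratMul.comp (fst.comp snd) (snd.comp snd)).to₂)

theorem primrec_evalCode : Primrec₂ evalCode :=
  list_foldr (list_map snd (primrec_monomialValue.comp (fst.comp fst) snd).to₂) (const (0, 0))
    (primrec_ratAdd.comp (fst.comp snd) (snd.comp snd)).to₂

theorem ratOfCode_foldr_ratMul (l : List (ℤ × ℕ)) :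
    ratOfCode (l.foldr ratMul (1, 0)) = (l.map ratOfCode).prod := by
  induction l with
  | nil => simp [ratOfCode]
  | cons a l ih => simp [ratOfCode_ratMul, ih]

theorem ratOfCode_foldr_ratAdd (l : List (ℤ × ℕ)) :
    ratOfCode (l.foldr ratAdd (0, 0)) = (l.map ratOfCode).sum := by
  induction l with
  | nil => simp [ratOfCode]
  | cons a l ih => simp [ratOfCode_ratAdd, ih]

theorem aeval_monomial_toFinsupp (x : ℕ → ℚ) (m : List ℕ) (c : ℤ) :
    MvPolynomial.aeval x (MvPolynomial.monomial m.toFinsupp c) =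
      c * ((List.range m.length).map fun i => x i ^ m.getD i 0).prod := by
  rw [MvPolynomial.aeval_monomial, Finsupp.prod_of_support_subset (s := Finset.range m.length)]
  · simp [Finset.prod, Finset.range, Multiset.range]
  · intro i hi
    rw [List.toFinsupp_support] at hi
    exact (Finset.mem_filter.1 hi).1
  · simp

theorem evalTuple_eq (l : List (List ℕ × ℤ)) (x : List (ℤ × ℕ)) :
    evalTuple (polyOfCode l) (x.map ratOfCode) = ratOfCode (evalCode x l) := by
  have h0 : ratOfCode (0, 0) = 0 := by simp [ratOfCode]
  have hx : ∀ i, (x.map ratOfCode).getD i 0 = ratOfCode (x.getD i (0, 0)) := fun i => by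
    rw [← h0, List.getD_map]
  rw [evalCode, ratOfCode_foldr_ratAdd, evalTuple, polyOfCode, map_list_sum, List.map_map,
    List.map_map]
  refine congrArg List.sum (List.map_congr_left fun t _ => ?_)
  simp only [Function.comp]
  rw [aeval_monomial_toFinsupp, monomialValue, ratOfCode_ratMul, ratOfCode_foldr_ratMul, List.map_map]
  congr 1
  · simp [ratOfCode]
  · refine congrArg List.prod (List.map_congr_left fun i _ => ?_)
    simp only [Function.comp, ratOfCode_ratPow, hx]

theorem primrec_evalTuple_eq_zero : PrimrecRel fun (l : List (List ℕ × ℤ)) (x : List (ℤ × ℕ)) =>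
    evalTuple (polyOfCode l) (x.map ratOfCode) = 0 := by
  refine (Primrec.eq.comp (fst.comp (primrec_evalCode.comp snd fst)) (const 0)).of_eq fun a => ?_
  show _ ↔ evalTuple (polyOfCode a.1) (a.2.map ratOfCode) = 0
  rw [evalTuple_eq, ratOfCode]
  have : ((evalCode a.2 a.1).2 : ℚ) + 1 ≠ 0 := by positivity
  simp [this]

end rat

end PriorityHTP

namespace PriorityHTP

open Primrec

/-! ### Primitive recursive operations on polynomials -/

/-- Codes of polynomials. -/
abbrev PolyCode : Type := List (List ℕ × ℤ)

/-- Addition of exponents. -/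
def expAdd (a b : List ℕ) : List ℕ :=
  (List.range (a.length + b.length)).map fun i => a.getD i 0 + b.getD i 0

theorem toFinsupp_expAdd (a b : List ℕ) :
    (expAdd a b).toFinsupp = a.toFinsupp + b.toFinsupp := by
  ext i
  rw [Finsupp.add_apply, List.toFinsupp_apply, List.toFinsupp_apply, List.toFinsupp_apply, expAdd]
  -- The sum of the lengths is a crude bound beyond which both exponents are 0; trailing zeros do
  -- not affect `toFinsupp`.
  by_cases hi : i < a.length + b.length
  · rw [List.getD_eq_getElem _ _ (by simpa using hi)]; simp
  · rw [List.getD_eq_default _ _ (by simpa using hi), List.getD_eq_default _ _ (by omega),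
      List.getD_eq_default _ _ (by omega), add_zero]

theorem primrec_expAdd : Primrec₂ expAdd :=
  list_map (list_range.comp (nat_add.comp (list_length.comp fst) (list_length.comp snd)))
    (nat_add.comp ((list_getD 0).comp (fst.comp fst) snd)
      ((list_getD 0).comp (snd.comp fst) snd)).to₂

namespace PolyCode

/-- Codes of constants. -/
def const (z : ℤ) : PolyCode := [([], z)]

/-- Codes of variables. -/
def var (i : ℕ) : PolyCode := [((List.range i).map (fun _ => 0) ++ [1], 1)]

/-- Addition of polynomials. -/
def add (l l' : PolyCode) : PolyCode := l ++ l'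

/-- Multiplication of polynomials. -/
def mul (l l' : PolyCode) : PolyCode :=
  l.flatMap fun t => l'.map fun t' => (expAdd t.1 t'.1, t.2 * t'.2)

/-- Subtraction of polynomials. -/
def sub (l l' : PolyCode) : PolyCode := add l (mul (const (-1)) l')

theorem polyOfCode_const (z : ℤ) : polyOfCode (const z) = MvPolynomial.C z := by
  simp only [polyOfCode, const, List.map_cons, List.map_nil, List.sum_cons, List.sum_nil, add_zero]
  rw [List.toFinsupp_nil]
  rfl

theorem polyOfCode_var (i : ℕ) : polyOfCode (var i) = MvPolynomial.X i := by
  simp only [polyOfCode, var, List.map_cons, List.map_nil, List.sum_cons, List.sum_nil, add_zero]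
  refine congrArg (fun s => MvPolynomial.monomial s (1 : ℤ)) ?_
  ext j
  rw [List.toFinsupp_apply, Finsupp.single_apply]
  rcases lt_trichotomy j i with h | h | h
  · rw [List.getD_append _ _ _ _ (by simpa using h), List.getD_eq_getElem _ _ (by simpa using h),
      if_neg h.ne']
    simp
  · subst h
    rw [List.getD_append_right _ _ _ _ (by simp)]
    simp
  · rw [List.getD_eq_default _ _ (by simpa using h), if_neg h.ne]

theorem polyOfCode_add (l l' : PolyCode) :
    polyOfCode (add l l') = polyOfCode l + polyOfCode l' := by
  simp [polyOfCode, add]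

theorem polyOfCode_mul (l l' : PolyCode) :
    polyOfCode (mul l l') = polyOfCode l * polyOfCode l' := by
  induction l with
  | nil => simp [polyOfCode, mul]
  | cons t l ih =>
    have h1 : mul (t :: l) l' = add (l'.map fun t' => (expAdd t.1 t'.1, t.2 * t'.2)) (mul l l') := by
      simp [mul, add]
    have h2 : polyOfCode (l'.map fun t' => (expAdd t.1 t'.1, t.2 * t'.2)) =
        MvPolynomial.monomial t.1.toFinsupp t.2 * polyOfCode l' := by
      rw [polyOfCode, polyOfCode, ← List.sum_map_mul_left, List.map_map]
      refine congrArg List.sum (List.map_congr_left fun t' _ => ?_)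
      simp only [Function.comp]
      rw [MvPolynomial.monomial_mul, toFinsupp_expAdd]
    rw [h1, polyOfCode_add, h2, ih, ← add_mul]
    simp [polyOfCode]

theorem polyOfCode_sub (l l' : PolyCode) :
    polyOfCode (sub l l') = polyOfCode l - polyOfCode l' := by
  rw [sub, polyOfCode_add, polyOfCode_mul, polyOfCode_const]
  simp [sub_eq_add_neg]

section primrec

variable {α : Type*} [Primcodable α]

theorem primrec_const {f : α → ℤ} (hf : Primrec f) : Primrec fun a => const (f a) :=
  list_cons.comp (Primrec.pair (Primrec.const []) hf) (Primrec.const [])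

theorem primrec_var {f : α → ℕ} (hf : Primrec f) : Primrec fun a => var (f a) :=
  list_cons.comp (Primrec.pair (list_append.comp
    (list_map (list_range.comp hf) (Primrec.const 0).to₂) (Primrec.const [1])) (Primrec.const 1))
    (Primrec.const [])

theorem primrec_add {f g : α → PolyCode} (hf : Primrec f) (hg : Primrec g) :
    Primrec fun a => add (f a) (g a) :=
  list_append.comp hf hg

theorem primrec_mul {f g : α → PolyCode} (hf : Primrec f) (hg : Primrec g) :
    Primrec fun a => mul (f a) (g a) :=
  list_flatMap hf (list_map (hg.comp fst) (Primrec.pair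
    (primrec_expAdd.comp (fst.comp (snd.comp fst)) (fst.comp snd))
    (primrec_int_mul.comp (snd.comp (snd.comp fst)) (snd.comp snd))).to₂).to₂

theorem primrec_sub {f g : α → PolyCode} (hf : Primrec f) (hg : Primrec g) :
    Primrec fun a => sub (f a) (g a) :=
  primrec_add hf (primrec_mul (primrec_const (Primrec.const (-1))) hg)

end primrec

open Classical in
theorem coeff_polyOfCode (m : ℕ →₀ ℕ) (l : PolyCode) :
    (polyOfCode l).coeff m = (l.map fun t => if t.1.toFinsupp = m then t.2 else 0).sum := by
  induction l with
  | nil => simp [polyOfCode]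
  | cons t l ih =>
    have : polyOfCode (t :: l) = MvPolynomial.monomial t.1.toFinsupp t.2 + polyOfCode l := by
      simp [polyOfCode]
    rw [this, MvPolynomial.coeff_add, ih, MvPolynomial.coeff_monomial]
    simp

theorem toFinsupp_eq_iff (a b : List ℕ) : a.toFinsupp = b.toFinsupp ↔
    ∀ i < a.length + b.length, a.getD i 0 = b.getD i 0 := by
  constructor
  · intro h i _
    have := DFunLike.congr_fun h i
    rwa [List.toFinsupp_apply, List.toFinsupp_apply] at this
  · intro h
    ext i
    rw [List.toFinsupp_apply, List.toFinsupp_apply]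
    by_cases hi : i < a.length + b.length
    · exact h i hi
    · rw [List.getD_eq_default _ _ (by omega), List.getD_eq_default _ _ (by omega)]

theorem primrec_toFinsupp_eq :
    PrimrecRel fun a b : List ℕ => a.toFinsupp = b.toFinsupp := by
  have h : PrimrecPred fun x : List ℕ × List ℕ =>
      ∀ i < x.1.length + x.2.length, x.1.getD i 0 = x.2.getD i 0 :=
    primrecPred_forall_lt (R := fun (x : List ℕ × List ℕ) i => x.1.getD i 0 = x.2.getD i 0)
      (nat_add.comp (list_length.comp fst) (list_length.comp snd))
      (Primrec.eq.comp ((list_getD 0).comp (fst.comp fst) snd)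
        ((list_getD 0).comp (snd.comp fst) snd))
  exact h.of_eq fun x => (toFinsupp_eq_iff x.1 x.2).symm

-- A code may repeat a monomial, also with different trailing zeros, so coefficients are sums over
-- terms with equal exponents. Only monomials occurring in the list need testing, which makes
-- equality of polynomials decidable on codes.
open Classical in
theorem polyOfCode_eq_zero_iff (l : PolyCode) : polyOfCode l = 0 ↔
    ∀ t ∈ l, (l.map fun t' => if t'.1.toFinsupp = t.1.toFinsupp then t'.2 else 0).sum = 0 := by
  constructor
  · intro h t _
    rw [← coeff_polyOfCode, h, MvPolynomial.coeff_zero]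
  · intro h
    ext m
    rw [MvPolynomial.coeff_zero]
    by_cases hm : ∃ t ∈ l, t.1.toFinsupp = m
    · obtain ⟨t, ht, rfl⟩ := hm
      rw [coeff_polyOfCode]
      exact h t ht
    · rw [coeff_polyOfCode]
      refine List.sum_eq_zero fun x hx => ?_
      obtain ⟨t, ht, rfl⟩ := List.mem_map.1 hx
      exact if_neg fun e => hm ⟨t, ht, e⟩

theorem primrec_polyOfCode_eq_zero : PrimrecPred fun l : PolyCode => polyOfCode l = 0 := by
  classical
  have h : PrimrecPred fun l : PolyCode => ∀ t ∈ l,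
      (l.map fun t' => if t'.1.toFinsupp = t.1.toFinsupp then t'.2 else 0).sum = 0 :=
    primrecPred_forall_mem (R := fun (l : PolyCode) (t : List ℕ × ℤ) =>
      (l.map fun t' => if t'.1.toFinsupp = t.1.toFinsupp then t'.2 else 0).sum = 0) Primrec.id
      (Primrec.eq.comp ((primrec_list_sum primrec_int_add).comp (list_map fst
        (Primrec.ite (primrec_toFinsupp_eq.comp (fst.comp snd) (fst.comp (snd.comp fst)))
          (snd.comp snd) (Primrec.const 0)).to₂)) (Primrec.const 0))
  exact h.of_eq fun l => (polyOfCode_eq_zero_iff l).symm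

theorem primrec_polyOfCode_eq :
    PrimrecRel fun l l' : PolyCode => polyOfCode l = polyOfCode l' :=
  (primrec_polyOfCode_eq_zero.comp (primrec_sub (α := PolyCode × PolyCode) fst snd)).of_eq
    fun x => by rw [polyOfCode_sub, sub_eq_zero]

/-- The code of `certificate`. -/
def certificate (p r : ℕ) (y : PolyCode) (N : ℕ) : PolyCode :=
  sub
    (mul (mul (add (add (add (add (const 1) (mul (var N) (var N)))
        (mul (var (N + 1)) (var (N + 1)))) (mul (var (N + 2)) (var (N + 2))))
        (mul (var (N + 3)) (var (N + 3))))
      (add (add (add (add (const 1) (mul (var N) (var N)))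
        (mul (var (N + 1)) (var (N + 1)))) (mul (var (N + 2)) (var (N + 2))))
        (mul (var (N + 3)) (var (N + 3)))))
      (add (const 4) (mul (const p) (mul
        (mul (const r) (mul (mul (mul y (sub y (const 1))) (sub y (const 2))) (sub y (const 3))))
        (mul (const r)
          (mul (mul (mul y (sub y (const 1))) (sub y (const 2))) (sub y (const 3))))))))
    (add (sub (mul (var (N + 4)) (var (N + 4)))
        (mul (const r) (mul (var (N + 5)) (var (N + 5)))))
      (mul (mul (const r) (const p)) (mul (var (N + 6)) (var (N + 6)))))

theorem polyOfCode_certificate (p r : ℕ) (y : PolyCode) (N : ℕ) :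
    polyOfCode (certificate p r y N) = PriorityHTP.certificate (MvPolynomial.C (p : ℤ))
      (MvPolynomial.C (r : ℤ)) (polyOfCode y) (fun i => MvPolynomial.X (N + i)) := by
  simp only [certificate, PriorityHTP.certificate, polyOfCode_sub, polyOfCode_add, polyOfCode_mul,
    polyOfCode_const, polyOfCode_var]
  have h4 : (MvPolynomial.C 4 : Poly) = 4 := map_ofNat MvPolynomial.C 4
  have h3 : (MvPolynomial.C 3 : Poly) = 3 := map_ofNat MvPolynomial.C 3
  have h2 : (MvPolynomial.C 2 : Poly) = 2 := map_ofNat MvPolynomial.C 2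
  rw [h4, h3, h2, MvPolynomial.C_1, add_zero]
  ring

theorem primrec_certificate {α : Type*} [Primcodable α] {p r N : α → ℕ} {y : α → PolyCode}
    (hp : Primrec p) (hr : Primrec r) (hy : Primrec y) (hN : Primrec N) :
    Primrec fun a => certificate (p a) (r a) (y a) (N a) := by
  have hv : ∀ k, Primrec fun a => mul (var (N a + k)) (var (N a + k)) := fun k =>
    primrec_mul (primrec_var (nat_add.comp hN (Primrec.const k)))
      (primrec_var (nat_add.comp hN (Primrec.const k)))
  have hc : ∀ k : ℤ, Primrec fun _ : α => const k := fun k => primrec_const (Primrec.const k)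
  have hp' : Primrec fun a => const (p a) := primrec_const (primrec_natCast.comp hp)
  have hr' : Primrec fun a => const (r a) := primrec_const (primrec_natCast.comp hr)
  have hZ := primrec_add (primrec_add (primrec_add (primrec_add (hc 1) (hv 0)) (hv 1)) (hv 2)) (hv 3)
  have hq := primrec_mul hr' (primrec_mul (primrec_mul (primrec_mul hy (primrec_sub hy (hc 1)))
    (primrec_sub hy (hc 2))) (primrec_sub hy (hc 3)))
  exact primrec_sub (primrec_mul (primrec_mul hZ hZ)
    (primrec_add (hc 4) (primrec_mul hp' (primrec_mul hq hq))))
    (primrec_add (primrec_sub (hv 4) (primrec_mul hr' (hv 5)))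
      (primrec_mul (primrec_mul hr' hp') (hv 6)))

/-- The code of `addCondition`. -/
def addCondition (N p r i : ℕ) (F : PolyCode) : PolyCode :=
  add (add (mul F F)
    (mul (certificate p r (var N) (N + 1)) (certificate p r (var N) (N + 1))))
    (mul (certificate p r (mul (var i) (add (const 1) (mul (const p) (var N)))) (N + 8))
      (certificate p r (mul (var i) (add (const 1) (mul (const p) (var N)))) (N + 8)))

theorem polyOfCode_addCondition (N p r i : ℕ) (F : PolyCode) :
    polyOfCode (addCondition N p r i F) = PriorityHTP.addCondition N p r i (polyOfCode F) := by
  simp only [addCondition, PriorityHTP.addCondition, conjunction, polyOfCode_add, polyOfCode_mul,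
    polyOfCode_certificate, polyOfCode_var, polyOfCode_const, MvPolynomial.C_1, sq, add_zero]
  simp only [add_assoc, add_comm, add_left_comm]

theorem primrec_addCondition {α : Type*} [Primcodable α] {N p r i : α → ℕ} {F : α → PolyCode}
    (hN : Primrec N) (hp : Primrec p) (hr : Primrec r) (hi : Primrec i) (hF : Primrec F) :
    Primrec fun a => addCondition (N a) (p a) (r a) (i a) (F a) := by
  have h1 := primrec_certificate hp hr (primrec_var hN) (nat_add.comp hN (Primrec.const 1))
  have h2 := primrec_certificate hp hr (primrec_mul (primrec_var hi)
    (primrec_add (primrec_const (Primrec.const 1))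
      (primrec_mul (primrec_const (primrec_natCast.comp hp)) (primrec_var hN))))
    (nat_add.comp hN (Primrec.const 8))
  exact primrec_add (primrec_add (primrec_mul hF hF) (primrec_mul h1 h1)) (primrec_mul h2 h2)

/-- The code of `addConditions`. -/
def addConditions (s : ℕ × PolyCode) (L : List (ℕ × ℕ × ℕ)) : ℕ × PolyCode :=
  L.foldl (fun s c => (s.1 + 15, addCondition s.1 c.1 c.2.1 c.2.2 s.2)) s

theorem addConditions_eq (L : List (ℕ × ℕ × ℕ)) : ∀ s : ℕ × PolyCode,
    PriorityHTP.addConditions (s.1, polyOfCode s.2) L =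
      ((addConditions s L).1, polyOfCode (addConditions s L).2) := by
  induction L with
  | nil => intro s; rfl
  | cons c L ih =>
    intro s
    have := ih (s.1 + 15, addCondition s.1 c.1 c.2.1 c.2.2 s.2)
    rw [polyOfCode_addCondition] at this
    exact this

theorem primrec_addConditions : Primrec₂ addConditions := by
  refine (list_foldl (f := fun x : (ℕ × PolyCode) × List (ℕ × ℕ × ℕ) => x.2) (g := fun x => x.1)
    (h := fun _ y => (y.1.1 + 15, addCondition y.1.1 y.2.1 y.2.2.1 y.2.2.2 y.1.2))
    snd fst ?_).of_eq fun _ => rfl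
  have h1 : Primrec fun z : ((ℕ × PolyCode) × List (ℕ × ℕ × ℕ)) × (ℕ × PolyCode) × (ℕ × ℕ × ℕ) =>
      z.2.1 := fst.comp snd
  have h2 : Primrec fun z : ((ℕ × PolyCode) × List (ℕ × ℕ × ℕ)) × (ℕ × PolyCode) × (ℕ × ℕ × ℕ) =>
      z.2.2 := snd.comp snd
  exact Primrec.pair (nat_add.comp (fst.comp h1) (Primrec.const 15))
    (primrec_addCondition (fst.comp h1) (fst.comp h2) (fst.comp (snd.comp h2))
      (snd.comp (snd.comp h2)) (snd.comp h1))

/-- A bound for the variables of a polynomial. -/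
def varBound (l : PolyCode) : ℕ := (l.map fun t => t.1.length).sum

theorem primrec_varBound : Primrec varBound :=
  (primrec_list_sum nat_add).comp (list_map Primrec.id (list_length.comp (fst.comp snd)).to₂)

theorem polyOfCode_mem_supported (l : PolyCode) :
    polyOfCode l ∈ MvPolynomial.supported ℤ {j | j < varBound l} := by
  refine Subalgebra.list_sum_mem _ fun F hF => ?_
  obtain ⟨t, ht, rfl⟩ := List.mem_map.1 hF
  rw [MvPolynomial.mem_supported]
  intro i hi
  have hi' := Finsupp.mem_support_iff.1 (MvPolynomial.mem_vars_iff_mem_support i |>.1 hi |>.choose_spec.2)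
  have hs := MvPolynomial.support_monomial_subset
    (MvPolynomial.mem_vars_iff_mem_support i |>.1 hi).choose_spec.1
  rw [Finset.mem_singleton] at hs
  rw [hs, List.toFinsupp_apply] at hi'
  have h1 : i < t.1.length := by
    by_contra h
    exact hi' (List.getD_eq_default _ _ (not_lt.1 h))
  exact lt_of_lt_of_le h1 (List.single_le_sum (fun _ _ => Nat.zero_le _) _
    (List.mem_map_of_mem (f := fun t : List ℕ × ℤ => t.1.length) ht))

/-- The conditions that the variables `X i`, for `i < N`, are in `ℤ_(p)`, for all `p` in a list. -/
noncomputable def localConditions (N : ℕ) (V : List ℕ) : List (ℕ × ℕ × ℕ) :=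
  V.flatMap fun p => (List.range N).map fun i => (p, nonresidue p, i)

theorem mem_localConditions {N : ℕ} {V : List ℕ} {c : ℕ × ℕ × ℕ} :
    c ∈ localConditions N V ↔ c.1 ∈ V ∧ c.2.1 = nonresidue c.1 ∧ c.2.2 < N := by
  obtain ⟨p, r, i⟩ := c
  simp only [localConditions, List.mem_flatMap, List.mem_map, List.mem_range, Prod.mk.injEq]
  constructor
  · rintro ⟨p', h1, i', h2, rfl, rfl, rfl⟩; exact ⟨h1, rfl, h2⟩
  · rintro ⟨h1, rfl, h2⟩; exact ⟨p, h1, i, h2, rfl, rfl, rfl⟩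

theorem primrec_localConditions : Primrec₂ localConditions :=
  list_flatMap snd (list_map (list_range.comp (fst.comp fst))
    (Primrec.pair (snd.comp fst) (Primrec.pair (primrec_nonresidue.comp (snd.comp fst)) snd)).to₂).to₂

/-- A polynomial with a root in `ℤ[M⁻¹]` if and only if `l` has one in `ℤ[(M ∖ V)⁻¹]`. -/
noncomputable def localize (l : PolyCode) (V : List ℕ) : PolyCode :=
  (addConditions (varBound l, l) (localConditions (varBound l) V)).2

theorem primrec_localize : Primrec₂ localize :=
  snd.comp (primrec_addConditions.comp (Primrec.pair (primrec_varBound.comp fst) fst)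
    (primrec_localConditions.comp (primrec_varBound.comp fst) snd))

theorem hasRootWith_localize {M : Set ℕ} (hM : ∀ p ∈ M, p.Prime) (l : PolyCode) {V : List ℕ}
    (hV : ∀ p ∈ V, p.Prime) :
    HasRootWith (ringInv M) (polyOfCode (localize l V)) (fun _ => True) ↔
      HasRootWith (ringInv (M \ {p | p ∈ V})) (polyOfCode l) (fun _ => True) := by
  rw [hasRootWith_ringInv_diff (V := {p | p ∈ V}) hM hV (polyOfCode_mem_supported l)]
  have h := hasRootWith_addConditions (A := ringInv M) (localConditions (varBound l) V)
    (polyOfCode_mem_supported l) fun c hc => by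
      obtain ⟨h1, h2, h3⟩ := mem_localConditions.1 hc
      exact ⟨hV _ h1, h2 ▸ isNonresidue_nonresidue (hV _ h1), h3⟩
  rw [addConditions_eq _ (varBound l, l)] at h
  refine h.trans ?_
  refine exists_congr fun x => and_congr_right fun _ => and_congr_right fun _ => ?_
  constructor
  · intro hc p hp i hi
    exact hc (p, nonresidue p, i) (mem_localConditions.2 ⟨hp, rfl, hi⟩)
  · intro hc c hc'
    obtain ⟨h1, -, h3⟩ := mem_localConditions.1 hc'
    exact hc _ h1 _ h3

end PolyCode

end PriorityHTP

namespace PriorityHTP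

open Primrec

/-! ### Computing the construction -/

theorem _root_.PrimrecPred.computablePred_comp {α β : Type*} [Primcodable α] [Primcodable β]
    {p : β → Prop} (hp : PrimrecPred p) {f : α → β} (hf : Computable f) :
    ComputablePred fun a => p (f a) := by
  obtain ⟨hd, hp⟩ := hp
  exact ⟨fun a => hd (f a), hp.to_comp.comp hf⟩

theorem computable_nat_rec {σ : Type*} [Primcodable σ] (x : σ) {step : ℕ → σ → σ}
    (hstep : Computable₂ step) : Computable fun s : ℕ => (Nat.rec x step s : σ) :=
  Computable.nat_rec (f := fun s : ℕ => s) (g := fun _ => x) (h := fun _ y => step y.1 y.2)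
    Computable.id (Computable.const _)
    (hstep.comp (Computable.fst.comp Computable.snd) (Computable.snd.comp Computable.snd)).to₂

theorem computable_map_range {q : ℕ → ℕ} (hq : Computable q) :
    Computable fun N => (List.range N).map q := by
  refine (computable_nat_rec [] (step := fun n l => l ++ [q n]) ?_).of_eq fun N => ?_
  · exact (Computable.list_concat.comp Computable.snd (hq.comp Computable.fst)).to₂
  · induction N with
    | zero => rfl
    | succ N ih => rw [List.range_succ, List.map_append, ← ih]; rfl

/-- The elements among the first `N` in the enumeration that do not divide `D`. -/
def outsideList (q : ℕ → ℕ) (D N : ℕ) : List ℕ :=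
  ((List.range N).map q).filter fun p => ¬ p ∣ D

theorem computable_outsideList {q : ℕ → ℕ} (hq : Computable q) :
    Computable fun x : ℕ × ℕ => outsideList q x.1 x.2 := by
  have h : Primrec fun x : ℕ × List ℕ => x.2.filter fun p => ¬ p ∣ x.1 :=
    primrec_filter (R := fun (x : ℕ × List ℕ) p => ¬ p ∣ x.1) snd
      (primrec_dvd.comp snd (fst.comp fst)).not
  exact (h.to_comp.comp (Computable.fst.pair
    ((computable_map_range hq).comp Computable.snd))).of_eq fun x => rfl

/-- A nonzero `D` has finitely many divisors and `q` is injective, so all but finitely many terms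
count. -/
theorem exists_le_length_filter {q : ℕ → ℕ} (hqinj : Function.Injective q) {D : ℕ} (hD : D ≠ 0)
    (n : ℕ) : ∃ N, n ≤ (outsideList q D N).length := by
  have hfin : ({k | q k ∣ D} : Set ℕ).Finite := by
    refine Set.Finite.preimage (s := {d | d ∣ D}) hqinj.injOn ?_
    exact (Finset.finite_toSet D.divisors).subset fun d hd => by simp [hD]; exact hd
  obtain ⟨t, ht, hcard⟩ := hfin.infinite_compl.exists_subset_card_eq n
  obtain ⟨N, hN⟩ := t.bddAbove
  refine ⟨N + 1, ?_⟩
  rw [outsideList, ← hcard, List.filter_map, List.length_map]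
  have : t ⊆ ((List.range (N + 1)).filter ((fun p => decide ¬ p ∣ D) ∘ q)).toFinset := by
    intro k hk
    simp only [List.mem_toFinset, List.mem_filter, List.mem_range, Function.comp, decide_eq_true_eq]
    exact ⟨Nat.lt_succ_of_le (hN hk), ht hk⟩
  exact (Finset.card_le_card this).trans (List.toFinset_card_le _)

theorem length_filter_range {q : ℕ → ℕ} {D N : ℕ} {S : Set ℕ} [DecidablePred fun k => q k ∉ S]
    (hS : ∀ k, q k ∈ S ↔ q k ∣ D) :
    (outsideList q D N).length =
      ((Finset.range N).filter fun k => q k ∉ S).card := by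
  rw [outsideList, List.filter_map, List.length_map, ← List.toFinset_card_of_nodup
    (List.Nodup.filter _ List.nodup_range)]
  congr 1
  ext k
  simp [hS]

/-- The bound is the least `N` such that `n` of the first `N` terms do not divide `D`, found by
unbounded search. -/
theorem exists_computable_bound {q : ℕ → ℕ} (hq : Computable q) (hqinj : Function.Injective q) :
    ∃ B : ℕ × ℕ → ℕ, Computable B ∧ ∀ D n, D ≠ 0 → ∀ i,
      i < B (D, n) ↔ ∀ m ≤ i, (outsideList q D m).length < n := by
  classical
  -- The alternative `x.1 = 0` only serves to make the search total.
  let P : ℕ × ℕ → ℕ → Prop := fun x N => x.1 = 0 ∨ x.2 ≤ (outsideList q x.1 N).length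
  have hex : ∀ x, ∃ N, P x N := by
    rintro ⟨D, n⟩
    by_cases hD : D = 0
    · exact ⟨0, Or.inl hD⟩
    · obtain ⟨N, hN⟩ := exists_le_length_filter hqinj hD n
      exact ⟨N, Or.inr hN⟩
  have hP : ComputablePred fun p : (ℕ × ℕ) × ℕ => P p.1 p.2 := by
    have h : PrimrecPred fun y : (ℕ × ℕ) × List ℕ => y.1.1 = 0 ∨ y.1.2 ≤ y.2.length :=
      (Primrec.eq.comp (fst.comp fst) (const 0)).or
        (nat_le.comp (snd.comp fst) (list_length.comp snd))
    exact h.computablePred_comp (f := fun p : (ℕ × ℕ) × ℕ => (p.1, outsideList q p.1.1 p.2))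
      (Computable.fst.pair ((computable_outsideList hq).comp
        ((Computable.fst.comp Computable.fst).pair Computable.snd)))
  refine ⟨_, Computable.find hP hex, fun D n hD i => ?_⟩
  rw [Nat.lt_find_iff]
  simp only [P, hD, false_or, not_le]

open Classical in
/-- The set of the first `n` elements of the enumeration that do not divide `D` is computable. -/
theorem exists_computable_firstOutside {q : ℕ → ℕ} (hq : Computable q)
    (hqinj : Function.Injective q) (hqprime : ∀ k, (q k).Prime) :
    ∃ V : ℕ × ℕ → List ℕ, Computable V ∧ ∀ D n, D ≠ 0 → ∀ p,
      p ∈ V (D, n) ↔ p ∈ firstOutside q {p | p.Prime ∧ p ∣ D} n := by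
  obtain ⟨B, hB, hBspec⟩ := exists_computable_bound hq hqinj
  refine ⟨fun x => outsideList q x.1 (B x),
    (computable_outsideList hq).comp (Computable.fst.pair hB), fun D n hD p => ?_⟩
  have hS : ∀ k, q k ∈ {p | p.Prime ∧ p ∣ D} ↔ q k ∣ D := fun k =>
    ⟨fun h => h.2, fun h => ⟨hqprime k, h⟩⟩
  have hiff : ∀ i, i < B (D, n) ↔
      ((Finset.range i).filter fun k => q k ∉ {p | p.Prime ∧ p ∣ D}).card < n := by
    intro i
    rw [hBspec D n hD]
    constructor
    · intro h
      rw [← length_filter_range hS]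
      exact h i le_rfl
    · intro h m hm
      rw [length_filter_range hS]
      exact lt_of_le_of_lt (Finset.card_le_card
        (Finset.filter_subset_filter _ (Finset.range_mono hm))) h
  simp only [outsideList, List.mem_filter, List.mem_map, List.mem_range, decide_eq_true_eq]
  constructor
  · rintro ⟨⟨i, hi, rfl⟩, h2⟩
    exact ⟨i, rfl, fun h => h2 ((hS i).1 h), by convert (hiff i).1 hi⟩
  · rintro ⟨i, rfl, h2, h3⟩
    exact ⟨⟨i, (hiff i).2 (by convert h3), rfl⟩, fun h => h2 ((hS i).2 h)⟩

/-- Search through the listing: it terminates because `f` is onto, and stops at the right index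
because `f` is injective on positive integers. -/
theorem exists_computable_polyIndex {f : ℕ → Poly} (hfcomp : ComputableVia polyOfCode f)
    (hf : Set.BijOn f (Set.Ici 1) Set.univ) :
    Computable fun l : PolyCode => polyIndex f (polyOfCode l) := by
  classical
  obtain ⟨F, hF, hFf⟩ := hfcomp
  let P : PolyCode → ℕ → Prop := fun l e => 0 < e ∧ polyOfCode (F e) = polyOfCode l
  have hex : ∀ l, ∃ e, P l e := fun l =>
    ⟨_, (polyIndex_spec hf (polyOfCode l)).1,
      (hFf _).trans (polyIndex_spec hf (polyOfCode l)).2⟩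
  have hP : ComputablePred fun p : PolyCode × ℕ => P p.1 p.2 := by
    have h : PrimrecPred fun y : ℕ × PolyCode × PolyCode =>
        0 < y.1 ∧ polyOfCode y.2.1 = polyOfCode y.2.2 :=
      (nat_lt.comp (const 0) fst).and
        (PolyCode.primrec_polyOfCode_eq.comp (fst.comp snd) (snd.comp snd))
    exact h.computablePred_comp (f := fun p : PolyCode × ℕ => (p.2, F p.2, p.1))
      (Computable.snd.pair ((hF.comp Computable.snd).pair Computable.fst))
  refine (Computable.find hP hex).of_eq fun l => ?_
  obtain ⟨h1, h2⟩ := Nat.find_spec (hex l)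
  exact ((congrArg (polyIndex f) (h2.symm.trans (hFf _))).trans (polyIndex_apply hf h1)).symm

/-- The product of the denominators of a tuple. -/
def denProd (x : List (ℤ × ℕ)) : ℕ := (x.map fun c => (ratOfCode c).den).prod

theorem primrec_denProd : Primrec denProd :=
  (primrec_list_prod nat_mul).comp (list_map Primrec.id (primrec_den.comp snd).to₂)

theorem denProd_ne_zero (x : List (ℤ × ℕ)) : denProd x ≠ 0 := by
  refine List.prod_ne_zero fun h => ?_
  obtain ⟨c, -, hc⟩ := List.mem_map.1 h
  exact (ratOfCode c).den_ne_zero hc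

theorem mem_denPrimes {p : ℕ} {x : List (ℤ × ℕ)} :
    p ∈ denPrimes (x.map ratOfCode) ↔ p.Prime ∧ p ∣ denProd x := by
  refine and_congr_right fun hp => ?_
  rw [denProd, Prime.dvd_prod_iff hp.prime]
  simp

open Classical in
/-- One stage of the construction, in terms of codes. The state is a number whose prime divisors
are the inverted primes, and the list of the indices whose variable is TRUE. -/
noncomputable def stepState (y : ℕ × List ℕ) (e : ℕ) (V : List ℕ)
    (c : PolyCode × List (ℤ × ℕ) × ℕ) : ℕ × List ℕ :=
  if e ∉ y.2 ∧ (∀ p ∈ V, ¬ p ∣ denProd c.2.1) ∧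
    evalTuple (polyOfCode c.1) (c.2.1.map ratOfCode) = 0
  then (y.1 * denProd c.2.1, e :: y.2) else y

theorem primrec_mem_list : PrimrecRel fun (e : ℕ) (l : List ℕ) => e ∈ l :=
  ((Primrec.eq (α := ℕ)).exists_mem_list.comp snd fst).of_eq fun x => by simp

theorem primrec_stepState : Primrec fun z : (ℕ × List ℕ) × ℕ × List ℕ × PolyCode ×
    List (ℤ × ℕ) × ℕ => stepState z.1 z.2.1 z.2.2.1 z.2.2.2 := by
  classical
  have hy : Primrec fun z : (ℕ × List ℕ) × ℕ × List ℕ × PolyCode × List (ℤ × ℕ) × ℕ => z.1 := fst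
  have he : Primrec fun z : (ℕ × List ℕ) × ℕ × List ℕ × PolyCode × List (ℤ × ℕ) × ℕ => z.2.1 :=
    fst.comp snd
  have hV : Primrec fun z : (ℕ × List ℕ) × ℕ × List ℕ × PolyCode × List (ℤ × ℕ) × ℕ => z.2.2.1 :=
    fst.comp (snd.comp snd)
  have hc : Primrec fun z : (ℕ × List ℕ) × ℕ × List ℕ × PolyCode × List (ℤ × ℕ) × ℕ => z.2.2.2 :=
    snd.comp (snd.comp snd)
  have hd := primrec_denProd.comp (fst.comp (snd.comp hc))
  have h2 := primrecPred_forall_mem hV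
    (R := fun (z : (ℕ × List ℕ) × ℕ × List ℕ × PolyCode × List (ℤ × ℕ) × ℕ) p =>
      ¬ p ∣ denProd z.2.2.2.2.1) (primrec_dvd.comp snd (hd.comp fst)).not
  exact Primrec.ite (((primrec_mem_list.comp he (snd.comp hy)).not).and
    (h2.and (primrec_evalTuple_eq_zero.comp (fst.comp hc) (fst.comp (snd.comp hc)))))
    (Primrec.pair (nat_mul.comp (fst.comp hy) hd) (list_cons.comp he (snd.comp hy))) hy

/-- The stages of the construction are computable. -/
theorem exists_computable_stage {q : ℕ → ℕ} {M : Set ℕ} {f : ℕ → Poly}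
    {g : ℕ → Poly × List ℚ × ℕ} {h : ℕ → ℕ} (hq : Computable q) (hqinj : Function.Injective q)
    (hqM : ∀ k, q k ∈ M) (hM : ∀ p ∈ M, p.Prime) (hfcomp : ComputableVia polyOfCode f)
    (hf : Set.BijOn f (Set.Ici 1) Set.univ) (hgcomp : ComputableVia tripleOfCode g)
    (hg : Set.BijOn g (Set.Ici 1) (triples M)) (hh : Computable h) :
    ∃ st : ℕ → ℕ × List ℕ, Computable st ∧ ∀ s, (st s).1 ≠ 0 ∧
      (stage q M f g h s).inverted = {p | p.Prime ∧ p ∣ (st s).1} ∧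
      ∀ e, e ∈ (stage q M f g h s).isTrue ↔ e ∈ (st s).2 := by
  obtain ⟨V, hV, hVspec⟩ := exists_computable_firstOutside hq hqinj fun k => hM _ (hqM k)
  have hidx := exists_computable_polyIndex hfcomp hf
  obtain ⟨G, hG, hGg⟩ := hgcomp
  let step : ℕ → ℕ × List ℕ → ℕ × List ℕ := fun s y =>
    stepState y (polyIndex f (polyOfCode (G (s + 1)).1)) (V (y.1, h (s + 1))) (G (s + 1))
  have hstep : Computable fun z : ℕ × ℕ × List ℕ => step z.1 z.2 := by
    have hs : Computable fun z : ℕ × ℕ × List ℕ => z.1 + 1 := Computable.succ.comp Computable.fst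
    have hGs := hG.comp hs
    have h1 := hidx.comp (Computable.fst.comp hGs)
    have h2 := hV.comp ((Computable.fst.comp (Computable.snd (α := ℕ) (β := ℕ × List ℕ))).pair
      (hh.comp hs))
    exact (primrec_stepState.to_comp.comp
      (Computable.snd.pair (h1.pair (h2.pair hGs)))).of_eq fun z => rfl
  -- Initially the number 1 has no prime divisors, and only the variable of index 0 is TRUE.
  refine ⟨fun s => s.rec (1, [0]) step, ?_, fun s => ?_⟩
  · exact computable_nat_rec _ hstep
  induction s with
  | zero =>
    refine ⟨one_ne_zero, ?_, ?_⟩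
    · ext p
      simp only [stage, Set.mem_empty_iff_false, false_iff]
      rintro ⟨hp, hd⟩
      exact hp.one_lt.ne' (Nat.dvd_one.1 hd)
    · simp [stage]
  | succ s ih =>
    obtain ⟨h1, h2, h3⟩ := ih
    beta_reduce at h1 h2 h3 ⊢
    generalize hy : (Nat.rec (1, [0]) step s : ℕ × List ℕ) = y at h1 h2 h3
    have hsucc : (Nat.rec (1, [0]) step (s + 1) : ℕ × List ℕ) = step s y := by rw [← hy]
    rw [hsucc]
    have e1 : (g (s + 1)).1 = polyOfCode (G (s + 1)).1 := by rw [← hGg]; rfl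
    have e2 : (g (s + 1)).2.1 = (G (s + 1)).2.1.map ratOfCode := by rw [← hGg]; rfl
    have hgt : g (s + 1) ∈ triples M := hg.mapsTo (Nat.succ_pos s)
    have hVp : ∀ p ∈ V (y.1, h (s + 1)), p.Prime := by
      intro p hp
      obtain ⟨i, rfl, -⟩ := (hVspec _ _ h1 _).1 hp
      exact hM _ (hqM i)
    have hV' : firstOutside q (stage q M f g h s).inverted (h (s + 1)) =
        {p | p ∈ V (y.1, h (s + 1))} := by
      ext p
      rw [h2]
      exact (hVspec _ _ h1 p).symm
    -- No decision procedure for `M` is needed: the listed tuples already have coordinates in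
    -- `ℤ[M⁻¹]`, so only the finitely many primes of `V` must be tested against the denominators.
    have hact : Acts q M f g h s ↔ (polyIndex f (polyOfCode (G (s + 1)).1) ∉ y.2 ∧
        (∀ p ∈ V (y.1, h (s + 1)), ¬ p ∣ denProd (G (s + 1)).2.1) ∧
        evalTuple (polyOfCode (G (s + 1)).1) ((G (s + 1)).2.1.map ratOfCode) = 0) := by
      rw [Acts, (polyIndex_spec hf _).2, h3, hV', e1, e2]
      refine and_congr_right fun _ => and_congr_left fun _ => ?_
      constructor
      · intro hr p hp hd
        obtain ⟨-, a, ha, hda⟩ := mem_denPrimes.2 ⟨hVp p hp, hd⟩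
        exact ((mem_ringInv fun p hp => hM p hp.1).1 (hr a ha) p (hVp p hp) hda).2 hp
      · intro hr a ha
        refine (mem_ringInv_diff hM (V := {p | p ∈ V (y.1, h (s + 1))}) hVp).2 ⟨?_, fun p hp => ?_⟩
        · exact hgt.2.1 a (by rw [e2]; exact ha)
        · rw [mem_localRing (hVp p hp)]
          exact fun hd => hr p hp (mem_denPrimes.1 ⟨hVp p hp, a, ha, hd⟩).2
    by_cases ha : Acts q M f g h s
    · rw [stage_succ_of_acts ha]
      have hst : step s y = (y.1 * denProd (G (s + 1)).2.1,
          polyIndex f (polyOfCode (G (s + 1)).1) :: y.2) := if_pos (hact.1 ha)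
      rw [hst]
      refine ⟨mul_ne_zero h1 (denProd_ne_zero _), ?_, fun e => ?_⟩
      · ext p
        rw [Set.mem_union, h2, e2, mem_denPrimes]
        constructor
        · rintro (⟨hp, hd⟩ | ⟨hp, hd⟩)
          exacts [⟨hp, hd.mul_right _⟩, ⟨hp, hd.mul_left _⟩]
        · rintro ⟨hp, hd⟩
          exact (hp.dvd_mul.1 hd).imp (fun h => ⟨hp, h⟩) fun h => ⟨hp, h⟩
      · rw [Set.mem_insert_iff, h3, e1, List.mem_cons]
    · rw [stage_succ_of_not_acts ha]
      have hst : step s y = y := if_neg fun hc => ha (hact.2 hc)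
      rw [hst]
      exact ⟨h1, h2, h3⟩

end PriorityHTP

namespace PriorityHTP

/-! ### Oracle computations -/

open Classical in
/-- A set is decided with an oracle for `B` by iterating a procedure that asks one question per
step. -/
theorem setTuringReducible_of_recursion {σ : Type} [Primcodable σ] {A B : Set ℕ} (st : ℕ → σ)
    {Φ : σ →. ℕ × σ} (hΦ : Partrec Φ) {upd : ℕ × σ → σ} (hupd : Computable upd)
    (hst : ∀ e, ∃ k τ, (k, τ) ∈ Φ (st e) ∧ st (e + 1) = upd (if k ∈ B then 1 else 0, τ))
    {out : ℕ × σ → ℕ} (hout : Computable out)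
    (ho : ∀ e, out (e, st e) = if e ∈ A then 1 else 0) : SetTuringReducible A B := by
  have h1 : Nat.RecursiveIn {charFun B} _ := Nat.Partrec.recursiveIn hΦ
  have h2 : Nat.RecursiveIn {charFun B} _ := Nat.Partrec.recursiveIn hupd
  have h3 : Nat.RecursiveIn {charFun B} _ := Nat.Partrec.recursiveIn hout
  have horacle : Nat.RecursiveIn {charFun B} (charFun B) := .oracle _ rfl
  -- One step: `Φ` yields a question and an intermediate state, the oracle replaces the question by
  -- its answer, and `upd` forms the next state.
  have hstep := h2.comp ((Nat.RecursiveIn.pair (horacle.comp .left) .right).comp h1)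
  generalize hS : (fun n => _ : ℕ →. ℕ) = step at hstep
  have hstep_eval : ∀ e, step (Encodable.encode (st e)) =
      Part.some (Encodable.encode (st (e + 1))) := by
    intro e
    obtain ⟨k, τ, hk, hs⟩ := hst e
    rw [hs, ← hS]
    have hc : (Part.some k >>= charFun B) = Part.some (if k ∈ B then 1 else 0) :=
      Part.bind_some _ _
    simp [Part.eq_some_iff.2 hk, Encodable.encode_prod_val, Seq.seq, hc]
  -- Iteration from the constant `st 0`; the recursion parameter is a dummy, set to 0 below.
  have hrec := Nat.RecursiveIn.prec (O := {charFun B})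
    (Nat.Partrec.recursiveIn (Computable.const (Encodable.encode (st 0)) :
      Computable fun _ : ℕ => Encodable.encode (st 0)))
    (hstep.comp (Nat.RecursiveIn.comp .right .right))
  generalize hR : (fun n => _ : ℕ →. ℕ) = rec at hrec
  have hrec_eval : ∀ e, rec (Nat.pair 0 e) = Part.some (Encodable.encode (st e)) := by
    intro e
    rw [← hR]
    simp only [Nat.unpair_pair]
    induction e with
    | zero => simp
    | succ e ih =>
      simp at ih ⊢
      rw [ih]
      simp [hstep_eval]
  have hz : Nat.RecursiveIn {charFun B} (fun n => Part.some (Nat.pair 0 n)) :=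
    Nat.Partrec.recursiveIn (Partrec.nat_iff.1
      (Primrec₂.natPair.comp (Primrec.const 0) Primrec.id).to_comp)
  have hid : Nat.RecursiveIn {charFun B} (fun n => Part.some n) :=
    Nat.Partrec.recursiveIn Nat.Partrec.some
  rw [SetTuringReducible, TuringReducible, RecursiveIn.iff_nat]
  refine (h3.comp (hid.pair (hrec.comp hz))).of_eq fun e => ?_
  simp [hrec_eval, Seq.seq, charFun, ho]

/-- The test, in terms of codes, which defines the stages `s_e`: the list `y.1` gives the values of
the characteristic function at `1, …, e - 1`, the number `y.2` is `s_{e-1}`, the list `l` gives the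
indices that are TRUE at stage `s`, and `i` is the index of the polynomial treated at stage `s`. -/
def KeyTest (y : List ℕ × ℕ) (s : ℕ) (l : List ℕ) (i : ℕ) : Prop :=
  y.2 < s ∧ (∀ j < y.1.length, y.1.getD j 0 = 1 → j + 1 ∈ l) ∧ i = y.1.length + 1

open Primrec in
theorem primrec_keyTest : PrimrecPred fun z : (List ℕ × ℕ) × ℕ × List ℕ × ℕ =>
    KeyTest z.1 z.2.1 z.2.2.1 z.2.2.2 := by
  have hlen : Primrec fun z : (List ℕ × ℕ) × ℕ × List ℕ × ℕ => z.1.1.length :=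
    list_length.comp (fst.comp fst)
  have h2 := primrecPred_forall_lt hlen
    (R := fun (z : (List ℕ × ℕ) × ℕ × List ℕ × ℕ) j => z.1.1.getD j 0 = 1 → j + 1 ∈ z.2.2.1)
    (((Primrec.eq.comp ((list_getD 0).comp (fst.comp (fst.comp fst)) snd) (const 1)).not.or
      (primrec_mem_list.comp (succ.comp snd) (fst.comp (snd.comp (snd.comp fst))))).of_eq
      fun _ => imp_iff_not_or.symm)
  exact (nat_lt.comp (snd.comp fst) (fst.comp snd)).and
    (h2.and (Primrec.eq.comp (snd.comp (snd.comp snd)) (succ.comp hlen)))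

-- The state carries the answers for `1, …, e` and the stage `s_e`. A step searches for the next key
-- stage, computes the primes protected there, and asks whether the polynomial `f (e + 1)`, with
-- integrality at these primes added, has a root in `ℤ[M⁻¹]`.
open Classical in
theorem setTuringReducible_HTP {q : ℕ → ℕ} {M : Set ℕ} {f : ℕ → Poly}
    {g : ℕ → Poly × List ℚ × ℕ} {h : ℕ → ℕ} (hq : Computable q) (hqinj : Function.Injective q)
    (hqM : ∀ k, q k ∈ M) (hM : ∀ p ∈ M, p.Prime) (hfcomp : ComputableVia polyOfCode f)
    (hf : Set.BijOn f (Set.Ici 1) Set.univ) (hgcomp : ComputableVia tripleOfCode g)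
    (hg : Set.BijOn g (Set.Ici 1) (triples M)) (hh : Computable h)
    (hadm : Admissible q M f g h) :
    SetTuringReducible (HTP f (ringInv (invertedSet q M f g h))) (HTP f (ringInv M)) := by
  obtain ⟨stc, hstc, hstcspec⟩ :=
    exists_computable_stage hq hqinj hqM hM hfcomp hf hgcomp hg hh
  obtain ⟨V, hV, hVspec⟩ := exists_computable_firstOutside hq hqinj fun k => hM _ (hqM k)
  have hidx := exists_computable_polyIndex hfcomp hf
  obtain ⟨F, hF, hFf⟩ := hfcomp
  obtain ⟨G, hG, hGg⟩ := hgcomp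
  obtain ⟨H, hH⟩ : ∃ H, H = HTP f (ringInv (invertedSet q M f g h)) := ⟨_, rfl⟩
  let T : List ℕ × ℕ → ℕ → Prop := fun y s =>
    KeyTest y s (stc s).2 (polyIndex f (polyOfCode (G s).1))
  have hT : ComputablePred fun z : (List ℕ × ℕ) × ℕ => T z.1 z.2 :=
    primrec_keyTest.computablePred_comp
      (f := fun z : (List ℕ × ℕ) × ℕ =>
        (z.1, z.2, (stc z.2).2, polyIndex f (polyOfCode (G z.2).1)))
      (Computable.fst.pair (Computable.snd.pair
        ((Computable.snd.comp (hstc.comp Computable.snd)).pair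
          (hidx.comp (Computable.fst.comp (hG.comp Computable.snd))))))
  -- The protected set at stage `s` is formed from the primes inverted before it, hence the index `s
  -- - 1`.
  let query : List ℕ × ℕ → ℕ → ℕ := fun y s => polyIndex f (polyOfCode
    (PolyCode.localize (F (y.1.length + 1)) (V ((stc (s - 1)).1, h s))))
  have hquery : Computable fun z : (List ℕ × ℕ) × ℕ => query z.1 z.2 := by
    have e1 : Computable fun z : (List ℕ × ℕ) × ℕ => F (z.1.1.length + 1) :=
      hF.comp (Computable.succ.comp
        (Computable.list_length.comp (Computable.fst.comp Computable.fst)))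
    have e2 : Computable fun z : (List ℕ × ℕ) × ℕ => V ((stc (z.2 - 1)).1, h z.2) :=
      hV.comp ((Computable.fst.comp (hstc.comp (Computable.pred.comp Computable.snd))).pair
        (hh.comp Computable.snd))
    exact hidx.comp (PolyCode.primrec_localize.to_comp.comp e1 e2)
  let st : ℕ → List ℕ × ℕ := fun e =>
    ((List.range e).map fun i => if i + 1 ∈ H then 1 else 0, keyStage q M f g h e)
  have hΦ : Partrec fun y : List ℕ × ℕ =>
      (Nat.rfind fun s => Part.some (decide (T y s))).map fun s => (query y s, (y.1, s)) :=
    (Partrec.rfind (p := fun y s => Part.some (decide (T y s))) hT.decide.partrec).map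
      (hquery.pair ((Computable.fst.comp Computable.fst).pair Computable.snd)).to₂
  have hupd : Computable fun z : ℕ × List ℕ × ℕ => (z.2.1 ++ [z.1], z.2.2) :=
    (Computable.list_concat.comp (Computable.fst.comp Computable.snd) Computable.fst).pair
      (Computable.snd.comp Computable.snd)
  -- The last of the `e` answers is the one for `e`. For `e = 0` the list is empty and `headI`
  -- returns 0, correctly, as 0 is never an element of `HTP`.
  have hout : Computable fun z : ℕ × List ℕ × ℕ => z.2.1.reverse.headI :=
    (Primrec.list_headI.comp (Primrec.list_reverse.comp
      (Primrec.fst.comp Primrec.snd))).to_comp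
  have hTiff : ∀ e s, T (st e) s ↔ keyStage q M f g h e < s ∧
      (∀ i, 1 ≤ i → i ≤ e → (∃ t, i ∈ (stage q M f g h t).isTrue) →
        i ∈ (stage q M f g h s).isTrue) ∧ ∃ x j, g s = (f (e + 1), x, j) := by
    intro e s
    simp only [T, KeyTest, st, List.length_map, List.length_range]
    refine and_congr_right fun _ => and_congr ?_ ?_
    · constructor
      · intro hb i h1 h2 h3
        obtain ⟨j, rfl⟩ : ∃ j, i = j + 1 := ⟨i - 1, by omega⟩
        rw [(hstcspec s).2.2]
        refine hb j (by omega) ?_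
        rw [List.getD_eq_getElem _ _ (by simpa using h2), List.getElem_map, List.getElem_range,
          if_pos (hH ▸ (mem_HTP_iff_exists_isTrue hM hf hg hadm j.succ_pos).2 h3)]
      · intro hb j hj h1
        rw [← (hstcspec s).2.2]
        refine hb (j + 1) (by omega) hj ?_
        rw [List.getD_eq_getElem _ _ (by simpa using hj), List.getElem_map,
          List.getElem_range] at h1
        have : j + 1 ∈ H := by by_contra hc; rw [if_neg hc] at h1; exact zero_ne_one h1
        exact (mem_HTP_iff_exists_isTrue hM hf hg hadm j.succ_pos).1 (hH ▸ this)
    · have e1 : (g s).1 = polyOfCode (G s).1 := by rw [← hGg]; rfl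
      rw [← e1]
      constructor
      · intro hi
        exact ⟨(g s).2.1, (g s).2.2, by rw [← hi, (polyIndex_spec hf _).2]⟩
      · rintro ⟨x, j, hgs⟩
        rw [hgs]
        exact polyIndex_apply hf e.succ_pos
  -- The unbounded search and the infimum defining `keyStage` both return the least stage passing
  -- the test.
  have hfind : ∀ e, keyStage q M f g h (e + 1) ∈
      Nat.rfind fun s => Part.some (decide (T (st e) s)) := by
    intro e
    refine Nat.mem_rfind.2 ⟨?_, fun {m} hm => ?_⟩
    · simpa [hTiff] using keyStage_spec (q := q) (f := f) (h := h) hg e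
    · have := Nat.notMem_of_lt_sInf hm
      rw [Set.mem_ofPred_eq, ← hTiff] at this
      simpa using this
  have hqm : ∀ e, query (st e) (keyStage q M f g h (e + 1)) ∈ HTP f (ringInv M) ↔ e + 1 ∈ H := by
    intro e
    obtain ⟨D, hD⟩ : ∃ D, D = (stc (keyStage q M f g h (e + 1) - 1)).1 := ⟨_, rfl⟩
    have hset : {p | p ∈ V (D, h (keyStage q M f g h (e + 1)))} =
        protectedPrimes q M f g h (keyStage q M f g h (e + 1)) := by
      ext p
      rw [protectedPrimes, (hstcspec _).2.1, ← hD, Set.mem_ofPred_eq]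
      exact hVspec _ _ (hD ▸ (hstcspec _).1) p
    have hVp : ∀ p ∈ V (D, h (keyStage q M f g h (e + 1))), p.Prime := by
      intro p hp
      obtain ⟨i, rfl, -⟩ := hset.subset hp
      exact hM _ (hqM i)
    rw [hH, mem_HTP_iff_hasRootWith hM hf hg hadm, ← hset, ← hFf (e + 1),
      ← PolyCode.hasRootWith_localize hM _ hVp, mem_HTP]
    simp only [query, st, List.length_map, List.length_range, ← hD]
    rw [(polyIndex_spec hf _).2]
    exact and_iff_right (polyIndex_spec hf _).1
  rw [← hH]
  refine setTuringReducible_of_recursion st hΦ hupd (fun e => ⟨_, _,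
    Part.mem_map _ (hfind e), ?_⟩) hout fun e => ?_
  · simp only [hqm, st, List.range_succ, List.map_append]
    rfl
  · cases e with
    | zero =>
      have : 0 ∉ H := fun h0 => by rw [hH] at h0; exact lt_irrefl 0 h0.1
      simp [st, this]
    | succ e => simp [st, List.range_succ]

/-- A prime is enumerated once it divides the number that codes the inverted primes of some stage.
-/
theorem rePred_invertedSet {q : ℕ → ℕ} {M : Set ℕ} {f : ℕ → Poly}
    {g : ℕ → Poly × List ℚ × ℕ} {h : ℕ → ℕ} (hq : Computable q) (hqinj : Function.Injective q)
    (hqM : ∀ k, q k ∈ M) (hM : ∀ p ∈ M, p.Prime) (hfcomp : ComputableVia polyOfCode f)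
    (hf : Set.BijOn f (Set.Ici 1) Set.univ) (hgcomp : ComputableVia tripleOfCode g)
    (hg : Set.BijOn g (Set.Ici 1) (triples M)) (hh : Computable h) :
    REPred fun p => p ∈ invertedSet q M f g h := by
  classical
  obtain ⟨stc, hstc, hstcspec⟩ :=
    exists_computable_stage hq hqinj hqM hM hfcomp hf hgcomp hg hh
  have hR : PrimrecPred fun z : ℕ × ℕ => z.1.Prime ∧ z.1 ∣ z.2 :=
    (primrec_prime.comp Primrec.fst).and (primrec_dvd.comp Primrec.fst Primrec.snd)
  have hP : ComputablePred fun z : ℕ × ℕ => z.1.Prime ∧ z.1 ∣ (stc z.2).1 :=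
    hR.computablePred_comp (f := fun z : ℕ × ℕ => (z.1, (stc z.2).1))
      (Computable.fst.pair (Computable.fst.comp (hstc.comp Computable.snd)))
  have hrf : Partrec fun p : ℕ =>
      Nat.rfind fun s => Part.some (decide (p.Prime ∧ p ∣ (stc s).1)) :=
    Partrec.rfind (p := fun (p s : ℕ) => Part.some (decide (p.Prime ∧ p ∣ (stc s).1)))
      hP.decide.partrec
  refine hrf.dom_re.of_eq fun p => Nat.rfind_dom.trans ?_
  rw [invertedSet, Set.mem_iUnion]
  refine exists_congr fun s => ?_
  rw [(hstcspec s).2.1]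
  simp

end PriorityHTP

theorem mainTheorem6
    -- an infinite c.e. set `W` of primes, with a computable enumeration without repetitions
    (W : Set ℕ) (hWprime : ∀ p ∈ W, p.Prime)
    (q : ℕ → ℕ) (hqcomp : Computable q) (hqinj : Function.Injective q) (hqW : Set.range q = W)
    -- a computable set `R` of primes outside `W`
    (R : Set ℕ) (hRprime : ∀ p ∈ R, p.Prime) (hRcomp : ComputablePred fun p => p ∈ R)
    (hRW : Disjoint R W)
    (M : Set ℕ) (hM : M = W ∪ R)
    -- computable bijective listings of the polynomials and of the triples, by positive integers
    (f : ℕ → PriorityHTP.Poly)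
    (hfcomp : PriorityHTP.ComputableVia PriorityHTP.polyOfCode f)
    (hfbij : Set.BijOn f (Set.Ici 1) Set.univ)
    (g : ℕ → PriorityHTP.Poly × List ℚ × ℕ)
    (hgcomp : PriorityHTP.ComputableVia PriorityHTP.tripleOfCode g)
    (hgbij : Set.BijOn g (Set.Ici 1) (PriorityHTP.triples M))
    -- the function `h`
    (h : ℕ → ℕ) (hhcomp : Computable h) (hh0 : h 0 = 0)
    (hadm : PriorityHTP.Admissible q M f g h) :
    REPred (fun p => p ∈ PriorityHTP.invertedSet q M f g h) ∧
    PriorityHTP.SetTuringReducible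
      (PriorityHTP.HTP f (PriorityHTP.ringInv (PriorityHTP.invertedSet q M f g h)))
      (PriorityHTP.HTP f (PriorityHTP.ringInv M)) := by
  have hqM : ∀ k, q k ∈ M := fun k => hM ▸ Or.inl (hqW ▸ Set.mem_range_self k)
  have hMp : ∀ p ∈ M, p.Prime := by
    rw [hM]
    rintro p (hp | hp)
    exacts [hWprime p hp, hRprime p hp]
  exact ⟨PriorityHTP.rePred_invertedSet hqcomp hqinj hqM hMp hfcomp hfbij hgcomp hgbij hhcomp,
    PriorityHTP.setTuringReducible_HTP hqcomp hqinj hqM hMp hfcomp hfbij hgcomp hgbij hhcomp hadm⟩
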